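/- \textbf{Proposition 3.} Binary strings have lengths $|\cdot|$; $C(x\mid v_1,\dots,v_k)$ is the conditional Kolmogorov complexity of $x$ given the tuple $(v_1,\dots,v_k)$ with respect to a fixed optimal decompressor, $C(x)$ is the complexity with the empty condition, and $I(x:y):=C(y)-C(y\mid x)$. For all constants $K$ and $c_0$ there are a constant $c_1$ and a function $k:\mathbb R\to\mathbb R$ (depending only on $K$, $c_0$ and the decompressor) such that the following holds. Let $n,d\ge 0$ be integers with $d\le Kn$, and let $x,y$ be strings such that, with $M:=|x|+|y|$, \[ |C(x)-n|\le c_0\log_2 (M+2),\qquad |C(y)-n|\le c_0\log_2 (M+2),\qquad |I(x:y)|\le c_0\log_2 (M+2). \] Then there is a string $z$ with $|z|\le (d+1)n$ such that, with $N:=|x|+|y|+|z|$, \[ |C(z)-(d+1)n|\le c_1\log_2 (N+2),\qquad |I(x:z)|\le c_1\log_2 (N+2),\qquad |I(y:z)|\le c_1\log_2 (N+2), \] and such that for every precision constant $c_2$ with $n\ge k(c_2)\log_2(M+2)$ there is no string $p$ of length $|p|<dn+0.99n$ for which at once, with $N':=|x|+|y|+|z|+|p|$, (i) $p$ is useful to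 get $x$ given $y$: $C(x\mid p,y)\le c_2\log_2 (N'+2)$, and (ii) $p$ is useless to get $x$ given $z$: $|C(x\mid p,z)-C(x\mid z)|\le c_2\log_2 (N'+2)$. -/

import Mathlib

namespace Kolm

/-- Binary strings. -/
abbrev Str : Type := List Bool

/-- A (conditional) decompressor: it takes a program and a finite tuple of strings (the condition)
and, if it halts, returns a string. -/
abbrev Machine : Type := Str × List Str →. Str

/-- An optimal decompressor: it is partial computable, and it simulates every other partial
computable decompressor with programs that are longer by at most an additive constant. -/
def IsOptimal (D : Machine) : Prop :=
  Partrec D ∧ ∀ D' : Machine, Partrec D' → ∃ c : ℕ, ∀ (q : Str) (v : List Str) (x : Str),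
    x ∈ D' (q, v) → ∃ p : Str, x ∈ D (p, v) ∧ p.length ≤ q.length + c

/-- The conditional Kolmogorov complexity `C(x | v₁, …, vₖ)` with respect to `D`: the least length
of a program that prints `x` given the condition `v = [v₁, …, vₖ]`. The unconditional complexity
`C(x)` is `C D x []`. -/
noncomputable def C (D : Machine) (x : Str) (v : List Str) : ℕ :=
  sInf {l : ℕ | ∃ p : Str, p.length = l ∧ x ∈ D (p, v)}

/-- The mutual information `I(x : y) = C(y) - C(y | x)`, the information in `x` on `y`. -/
noncomputable def I (D : Machine) (x y : Str) : ℝ :=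
  (C D y [] : ℝ) - (C D y [x] : ℝ)

/-- The unit of precision `log N`; the shift by 2 only makes it at least 1 when `N` is 0 or 1. -/
noncomputable def lg (N : ℕ) : ℝ := Real.logb 2 ((N : ℝ) + 2)

/-- Equality up to a logarithmic term, `|a - b| ≤ c · log N`. -/
def ApproxEq (c : ℝ) (N : ℕ) (a b : ℝ) : Prop := |a - b| ≤ c * lg N

/-- `p` is useful to get `x` given `y`: `C(x | p, y) = 0` up to `c · log N`. -/
def Useful (D : Machine) (c : ℝ) (N : ℕ) (p x y : Str) : Prop :=
  ApproxEq c N (C D x [p, y]) 0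

/-- `p` is useless to get `x` given `z`: `C(x | p, z) = C(x | z)` up to `c · log N`. -/
def Useless (D : Machine) (c : ℝ) (N : ℕ) (p x z : Str) : Prop :=
  ApproxEq c N (C D x [p, z]) (C D x [z])

/-- With an optimal decompressor every string has a program under every condition, so the infimum
in the definition of `C` is attained. -/
theorem IsOptimal.exists_program {D : Machine} (hD : IsOptimal D) (x : Str) (v : List Str) :
    ∃ p : Str, p.length = C D x v ∧ x ∈ D (p, v) := by
  obtain ⟨c, hc⟩ := hD.2 (fun a => Part.some a.1) Computable.fst.partrec
  obtain ⟨p, hp, -⟩ := hc x v x (Part.mem_some x)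
  exact Nat.sInf_mem (s := {l : ℕ | ∃ p : Str, p.length = l ∧ x ∈ D (p, v)}) ⟨_, p, rfl, hp⟩

/-- Optimal decompressors exist: read `1ᵉ0p` as the program `p` for the `e`-th machine. -/
theorem exists_isOptimal : ∃ D : Machine, IsOptimal D := by
  let idx : Str × List Str → ℕ := fun a => a.1.findIdx (fun b => !b)
  have hidx : Primrec idx :=
    Primrec.list_findIdx Primrec.fst ((Primrec.not.comp Primrec.snd).to₂)
  have hrest : Primrec (fun a : Str × List Str => a.1.drop (idx a + 1)) :=
    Primrec.list_drop.comp (Primrec.succ.comp hidx) Primrec.fst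
  have hcode : Computable (fun a : Str × List Str =>
      Denumerable.ofNat Nat.Partrec.Code (idx a)) :=
    ((Primrec.ofNat Nat.Partrec.Code).comp hidx).to_comp
  have hin : Computable (fun a : Str × List Str =>
      Encodable.encode (a.1.drop (idx a + 1), a.2)) :=
    (Primrec.encode.comp (hrest.pair Primrec.snd)).to_comp
  let U : Machine := fun a =>
    ((Denumerable.ofNat Nat.Partrec.Code (idx a)).eval
      (Encodable.encode (a.1.drop (idx a + 1), a.2))).bind
      (fun n => (Encodable.decode (α := Str) n : Part Str))
  refine ⟨U, ?_, ?_⟩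
  · refine Partrec.bind (Nat.Partrec.Code.eval_part.comp hcode hin) ?_
    exact (Computable.ofOption (Computable.decode.comp Computable.snd)).to₂
  · intro D' hD'
    obtain ⟨code, hcd⟩ := Nat.Partrec.Code.exists_code.1 hD'
    refine ⟨Encodable.encode code + 1, fun q v x hx => ?_⟩
    have hi : (List.replicate (Encodable.encode code) true ++ false :: q).findIdx (fun b => !b)
        = Encodable.encode code := by
      induction Encodable.encode code with
      | zero => simp [List.findIdx_cons]
      | succ k ih => simp [List.replicate_succ, List.findIdx_cons, ih]
    refine ⟨List.replicate (Encodable.encode code) true ++ false :: q, ?_, ?_⟩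
    · have hd : (List.replicate (Encodable.encode code) true ++ false :: q).drop
          (Encodable.encode code + 1) = q := by
        simp [List.drop_append]
      simp only [U, idx, hi, hd, Denumerable.ofNat_encode, hcd]
      simp only [Encodable.encodek, Part.coe_some, Part.bind_some]
      refine Part.mem_bind_iff.2 ⟨Encodable.encode x, Part.mem_map _ hx, ?_⟩
      simp [Encodable.encodek]
    · simp; omega

end Kolm

/-! A string `z` of length `L = (d+1)n` is read as a curve: a number whose residue modulo a prime
attached to `x'` singles out the one `y'` that may lie above `x'`. Two curves of the same length `L`
share at most `L` points, because the primes of all common points divide the difference of the two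
numbers (`exists_incidence`).

Take `z` random among the roughly `2^(L-n)` curves through `(x, y)`. Few of these are simple given
`x`: otherwise `y` would be one of the few strings joined to `x` by many simple curves,
contradicting `C(y | x) ≈ n`. The same holds with `x` and `y` exchanged, so some `z` is
incompressible given either one (`exists_curve`). Symmetry of information then gives `C(x | z) ≈ n`.

Now let `C(x | p, y) ≤ l`. At most about `2^(n+l)` points `(x', y')` satisfy `C(x' | p, y') ≤ l`. If
`z` carries fewer than `2^t` of them, then `C(x | p, z) ≤ t + O(log)`. Otherwise `z` is one of the
curves carrying many of them; since curves are almost disjoint, a Bonferroni count leaves about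
`2^(n+l-t)` of these, so `C(z | p)` is at most about `n + l - t` (`complexity_le_or_complexity_le`).
For `t` just below `n` the first alternative contradicts uselessness, and the second gives `|p| ≥
C(z) - C(z | p) ≈ L`, which exceeds `dn + 0.99n` (`exists_inseparable`). If `L` exceeds `n` by only
`O(log)`, there is no room for a curve; a `z` random given `x` and `y` suffices, since already `|p|
≥ C(x | y) - C(x | p, y) ≈ n ≈ L`.

The counting bounds become complexity bounds through one principle, `complexity_le_add_log`: a
member of an enumerable set of at most `2^s` elements costs `s` bits plus the logarithms of the
parameters. This is why every set in use is shown to be `Σ₁`. -/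

namespace Kolm

/-! ### `Σ₁` relations and their enumerations -/

/-- A predicate with a primitive recursive matrix behind one unbounded existential quantifier. -/
def SigmaOne {α : Type*} [Primcodable α] (p : α → Prop) : Prop :=
  ∃ q : α → ℕ → Bool, Primrec₂ q ∧ ∀ a, p a ↔ ∃ t, q a t = true

/-- At least `T` elements satisfy `p`. -/
def AtLeast {β : Type*} (T : ℕ) (p : β → Prop) : Prop :=
  ∃ F : Finset β, T ≤ F.card ∧ ∀ b ∈ F, p b

theorem card_lt_of_not_atLeast {β : Type*} {T : ℕ} {p : β → Prop} (h : ¬ AtLeast T p)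
    (F : Finset β) (hF : ∀ b ∈ F, p b) : F.card < T := by
  by_contra hc
  exact h ⟨F, not_lt.1 hc, hF⟩

/-- This form of `Nodup` is an equality of primitive recursive lists, so it is visibly decidable by
a primitive recursive test. -/
theorem nodup_iff_map_idxOf {β : Type*} [DecidableEq β] (l : List β) :
    l.Nodup ↔ l.map (fun b => l.idxOf b) = List.range l.length := by
  constructor
  · intro h
    refine List.ext_getElem (by simp) fun i h1 h2 => ?_
    simp [h.idxOf_getElem]
  · intro h
    exact List.Nodup.of_map _ (h ▸ List.nodup_range)

namespace SigmaOne

variable {α β : Type*} [Primcodable α] [Primcodable β]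

theorem of_primrecPred {p : α → Prop} (hp : PrimrecPred p) : SigmaOne p := by
  obtain ⟨_, hp⟩ := hp
  exact ⟨fun a _ => decide (p a), (hp.comp Primrec.fst).to₂, fun a => by simp⟩

theorem of_eq {p q : α → Prop} (hp : SigmaOne p) (h : ∀ a, p a ↔ q a) : SigmaOne q :=
  funext (fun a => propext (h a)) ▸ hp

theorem comp {p : β → Prop} {f : α → β} (hp : SigmaOne p) (hf : Primrec f) :
    SigmaOne fun a => p (f a) := by
  obtain ⟨q, hq, h⟩ := hp
  exact ⟨fun a t => q (f a) t, hq.comp (hf.comp Primrec.fst) Primrec.snd, fun a => h (f a)⟩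

theorem and {p p' : α → Prop} (hp : SigmaOne p) (hp' : SigmaOne p') :
    SigmaOne fun a => p a ∧ p' a := by
  obtain ⟨q, hq, h⟩ := hp
  obtain ⟨q', hq', h'⟩ := hp'
  have h1 : Primrec fun x : α × ℕ => x.2.unpair := Primrec.unpair.comp Primrec.snd
  refine ⟨fun a t => q a t.unpair.1 && q' a t.unpair.2,
    Primrec.and.comp (hq.comp Primrec.fst (Primrec.fst.comp h1))
      (hq'.comp Primrec.fst (Primrec.snd.comp h1)), fun a => ?_⟩
  change p a ∧ p' a ↔ _
  rw [h, h']
  constructor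
  · rintro ⟨⟨s, hs⟩, ⟨t, ht⟩⟩
    exact ⟨Nat.pair s t, by simp [hs, ht]⟩
  · rintro ⟨t, ht⟩
    simp only [Bool.and_eq_true] at ht
    exact ⟨⟨_, ht.1⟩, ⟨_, ht.2⟩⟩

theorem ex {p : α → β → Prop} (hp : SigmaOne fun a : α × β => p a.1 a.2) :
    SigmaOne fun a => ∃ b, p a b := by
  obtain ⟨q, hq, h⟩ := hp
  have h1 : Primrec fun x : α × ℕ => x.2.unpair := Primrec.unpair.comp Primrec.snd
  refine ⟨fun a t => Option.casesOn (Encodable.decode (α := β) t.unpair.1) false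
    (fun b => q (a, b) t.unpair.2), ?_, fun a => ?_⟩
  · refine Primrec.option_casesOn (Primrec.decode.comp (Primrec.fst.comp h1)) (Primrec.const false) ?_
    exact hq.comp ((Primrec.fst.comp Primrec.fst).pair Primrec.snd)
      (Primrec.snd.comp (h1.comp Primrec.fst))
  · constructor
    · rintro ⟨b, hb⟩
      obtain ⟨t, ht⟩ := (h (a, b)).1 hb
      exact ⟨Nat.pair (Encodable.encode b) t, by simp [ht]⟩
    · rintro ⟨t, ht⟩
      cases hd : (Encodable.decode (α := β) t.unpair.1) with
      | none => simp [hd] at ht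
      | some b => exact ⟨b, (h (a, b)).2 ⟨_, by simpa [hd] using ht⟩⟩

/-- Finitely many witnesses have a common bound, so the bounded quantifier can be moved into the
matrix. -/
theorem ball {p : α → β → Prop} (hp : SigmaOne fun a : α × β => p a.1 a.2) {f : α → List β}
    (hf : Primrec f) : SigmaOne fun a => ∀ b ∈ f a, p a b := by
  obtain ⟨q, hq, h⟩ := hp
  have h1 : PrimrecRel fun (s : ℕ) (x : α × β) => q x s = true :=
    Primrec.eq.comp (hq.comp Primrec.snd Primrec.fst) (Primrec.const true)
  have h2 : PrimrecRel fun (b : β) (x : α × ℕ) => ∃ s ∈ List.range x.2, q (x.1, b) s = true :=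
    h1.exists_mem_list.comp (Primrec.list_range.comp (Primrec.snd.comp Primrec.snd))
      ((Primrec.fst.comp Primrec.snd).pair Primrec.fst)
  have h3 : PrimrecPred fun x : α × ℕ => ∀ b ∈ f x.1, ∃ s ∈ List.range x.2, q (x.1, b) s = true :=
    h2.forall_mem_list.comp (hf.comp Primrec.fst) Primrec.id
  classical
  refine ⟨fun a t => decide (∀ b ∈ f a, ∃ s ∈ List.range t, q (a, b) s = true), h3.decide, fun a => ?_⟩
  simp only [decide_eq_true_eq, List.mem_range]
  constructor
  · intro hb
    have : ∀ b ∈ f a, ∃ s, q (a, b) s = true := fun b hm => (h (a, b)).1 (hb b hm)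
    generalize f a = l at this
    clear hb
    induction l with
    | nil => exact ⟨0, by simp⟩
    | cons b l ih =>
      obtain ⟨t, ht⟩ := ih (fun b hm => this b (List.mem_cons_of_mem _ hm))
      obtain ⟨s, hs⟩ := this b List.mem_cons_self
      refine ⟨max t (s + 1), fun b' hb' => ?_⟩
      rcases List.mem_cons.1 hb' with rfl | hb'
      · exact ⟨s, by omega, hs⟩
      · obtain ⟨s', h1, h2⟩ := ht b' hb'
        exact ⟨s', by omega, h2⟩
  · rintro ⟨t, ht⟩ b hb
    obtain ⟨s, -, hs⟩ := ht b hb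
    exact (h (a, b)).2 ⟨s, hs⟩

theorem primrecPred_nodup : PrimrecPred fun l : List β => l.Nodup := by
  classical
  refine PrimrecPred.of_eq (p := fun l : List β => l.map (fun b => l.idxOf b) = List.range l.length)
    ?_ fun l => (nodup_iff_map_idxOf l).symm
  exact Primrec.eq.comp (Primrec.list_map Primrec.id (Primrec.list_idxOf.comp Primrec.snd Primrec.fst))
    (Primrec.list_range.comp Primrec.list_length)

/-- A lower bound on a cardinality is certified by a finite list. The same argument does not apply
to upper bounds, so later enumerable sets are defined by "at least `2^t`" and their sizes are
bounded separately. -/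
theorem atLeast {p : α → β → Prop} (hp : SigmaOne fun a : α × β => p a.1 a.2) {T : α → ℕ}
    (hT : Primrec T) : SigmaOne fun a => AtLeast (T a) (p a) := by
  classical
  have h1 : SigmaOne fun x : α × List β => x.2.Nodup :=
    of_primrecPred (primrecPred_nodup.comp Primrec.snd)
  have h2 : SigmaOne fun x : α × List β => T x.1 ≤ x.2.length :=
    of_primrecPred (Primrec.nat_le.comp (hT.comp Primrec.fst) (Primrec.list_length.comp Primrec.snd))
  have h3 : SigmaOne fun x : α × List β => ∀ b ∈ x.2, p x.1 b :=
    ball (p := fun (x : α × List β) b => p x.1 b)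
      (hp.comp ((Primrec.fst.comp Primrec.fst).pair Primrec.snd)) Primrec.snd
  refine of_eq (ex (p := fun a (l : List β) => l.Nodup ∧ T a ≤ l.length ∧ ∀ b ∈ l, p a b)
    (h1.and (h2.and h3))) fun a => ?_
  constructor
  · rintro ⟨l, hl, hT, hp⟩
    exact ⟨l.toFinset, by rwa [List.toFinset_card_of_nodup hl], by simpa using hp⟩
  · rintro ⟨F, hT, hp⟩
    exact ⟨F.toList, F.nodup_toList, by simpa using hT, by simpa using hp⟩

theorem mem_partrec {f : α →. β} (hf : Partrec f) :
    SigmaOne fun x : β × α => x.1 ∈ f x.2 := by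
  obtain ⟨c, hc⟩ := Nat.Partrec.Code.exists_code.1 hf
  have h1 : Primrec fun x : (β × α) × ℕ =>
      Nat.Partrec.Code.evaln x.2 c (Encodable.encode x.1.2) :=
    Nat.Partrec.Code.primrec_evaln.comp
      ((Primrec.snd.pair (Primrec.const c)).pair
        (Primrec.encode.comp (Primrec.snd.comp Primrec.fst)))
  have h2 : PrimrecPred fun x : (β × α) × ℕ =>
      Nat.Partrec.Code.evaln x.2 c (Encodable.encode x.1.2) = some (Encodable.encode x.1.1) :=
    Primrec.eq.comp h1
      (Primrec.option_some.comp (Primrec.encode.comp (Primrec.fst.comp Primrec.fst)))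
  refine ⟨fun x t => decide (Nat.Partrec.Code.evaln t c (Encodable.encode x.2)
    = some (Encodable.encode x.1)), h2.decide, fun x => ?_⟩
  simp only [decide_eq_true_eq]
  have h3 := Nat.Partrec.Code.evaln_complete (c := c) (n := Encodable.encode x.2)
    (x := Encodable.encode x.1)
  simp only [Option.mem_def] at h3
  rw [← h3, hc]
  simp [Encodable.encodek]

/-- A `Σ₁` relation has a primitive recursive enumeration without repetitions. -/
theorem exists_enumeration {p : α → β → Prop} (hp : SigmaOne fun a : α × β => p a.1 a.2) :
    ∃ A : α → ℕ → List β, Primrec₂ A ∧ (∀ a T, (A a T).Nodup) ∧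
      (∀ a T T', T ≤ T' → A a T <+: A a T') ∧ (∀ a T, ∀ b ∈ A a T, p a b) ∧
      ∀ a b, p a b → ∃ T, b ∈ A a T := by
  classical
  obtain ⟨q, hq, h⟩ := hp
  -- Stage `u` codes a candidate `b` together with a possible witness for it; `S` then appends an
  -- accepted candidate unless it is already listed.
  let E : α → ℕ → Option β := fun a u =>
    (Encodable.decode (α := β) u.unpair.1).bind fun b => if q (a, b) u.unpair.2 then some b else none
  have hu : Primrec fun x : α × ℕ => x.2.unpair := Primrec.unpair.comp Primrec.snd
  have hE : Primrec₂ E := by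
    refine Primrec.option_bind (Primrec.decode.comp (Primrec.fst.comp hu)) ?_
    refine Primrec.ite ?_ (Primrec.option_some.comp Primrec.snd) (Primrec.const none)
    exact Primrec.eq.comp (hq.comp ((Primrec.fst.comp Primrec.fst).pair Primrec.snd)
      (Primrec.snd.comp (hu.comp Primrec.fst))) (Primrec.const true)
  let S : List β → Option β → List β := fun l o =>
    Option.casesOn o l fun b => if b ∈ l then l else l ++ [b]
  have hS : Primrec₂ S := by
    refine Primrec.option_casesOn Primrec.snd Primrec.fst ?_
    refine Primrec.ite ?_ (Primrec.fst.comp Primrec.fst)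
      (Primrec.list_concat.comp (Primrec.fst.comp Primrec.fst) Primrec.snd)
    refine PrimrecPred.of_eq (p := fun x : (List β × Option β) × β => ∃ c ∈ x.1.1, c = x.2)
      ?_ fun x => by simp
    exact Primrec.eq.exists_mem_list.comp (Primrec.fst.comp Primrec.fst) Primrec.snd
  let A : α → ℕ → List β := fun a T => Nat.rec [] (fun u l => S l (E a u)) T
  have hA : Primrec₂ A := by
    refine Primrec.nat_rec (α := α) (f := fun _ => ([] : List β))
      (g := fun a x => S x.2 (E a x.1)) (Primrec.const []) ?_
    exact hS.comp (Primrec.snd.comp Primrec.snd) (hE.comp Primrec.fst (Primrec.fst.comp Primrec.snd))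
  have hA1 : ∀ a T, A a (T + 1) = S (A a T) (E a T) := fun a T => rfl
  have hEp : ∀ a u b, E a u = some b → p a b := by
    intro a u b hb
    simp only [E, Option.bind_eq_some_iff] at hb
    obtain ⟨b', -, hb⟩ := hb
    split_ifs at hb with hc
    · cases hb
      exact (h (a, b)).2 ⟨_, hc⟩
  have hSpre : ∀ l o, l <+: S l o := by
    intro l o
    cases o with
    | none => exact List.prefix_rfl
    | some b =>
      simp only [S]
      split_ifs
      · exact List.prefix_rfl
      · exact List.prefix_append _ _
  have hSnd : ∀ l o, l.Nodup → (S l o).Nodup := by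
    intro l o hl
    cases o with
    | none => exact hl
    | some b =>
      simp only [S]
      split_ifs with hb
      · exact hl
      · exact List.nodup_append.2 ⟨hl, by simp, by rintro x hx y hy rfl; simp at hy; exact hb (hy ▸ hx)⟩
  have hSmem : ∀ l o b, b ∈ S l o ↔ b ∈ l ∨ o = some b := by
    intro l o b
    cases o with
    | none => simp [S]
    | some b' =>
      simp only [S]
      split_ifs with hb
      · simp only [Option.some.injEq]
        exact ⟨Or.inl, fun h => h.elim id fun h => h ▸ hb⟩
      · simp [eq_comm]
  refine ⟨A, hA, fun a T => ?_, fun a T T' hT => ?_, fun a T => ?_, fun a b hab => ?_⟩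
  · induction T with
    | zero => simp [A]
    | succ T ih => rw [hA1]; exact hSnd _ _ ih
  · induction T', hT using Nat.le_induction with
    | base => exact List.prefix_rfl
    | succ T' _ ih => rw [hA1]; exact ih.trans (hSpre _ _)
  · induction T with
    | zero => simp [A]
    | succ T ih =>
      intro b hb
      rw [hA1, hSmem] at hb
      exact hb.elim (ih b) (hEp a T b)
  · obtain ⟨t, ht⟩ := (h (a, b)).1 hab
    refine ⟨Nat.pair (Encodable.encode b) t + 1, ?_⟩
    rw [hA1, hSmem]
    right
    simp [E, ht]

/-- The elements of a `Σ₁` relation get ranks, in the order of an enumeration. -/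
theorem exists_rank {p : α → β → Prop} (hp : SigmaOne fun a : α × β => p a.1 a.2) :
    ∃ R : α → ℕ → β → Prop, (SigmaOne fun x : α × ℕ × β => R x.1 x.2.1 x.2.2) ∧
      (∃ f : α × ℕ →. β, Partrec f ∧ ∀ a i b, R a i b ↔ b ∈ f (a, i)) ∧
      (∀ a i j b, R a i b → R a j b → i = j) ∧
      (∀ a i b, R a i b → p a b) ∧
      ∀ a b N, p a b → (∀ F : Finset β, (∀ c ∈ F, p a c) → F.card ≤ N) → ∃ i < N, R a i b := by
  classical
  obtain ⟨A, hA, hnd, hpre, hsound, hcomp⟩ := exists_enumeration hp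
  -- Each stage is a prefix of the later ones, so an element never changes its position; that
  -- position is its rank.
  have hmono : ∀ (a : α) (i : ℕ) {b : β} {T T' : ℕ}, T ≤ T' → b ∈ (A a T)[i]? → b ∈ (A a T')[i]? := by
    intro a i b T T' hT hb
    rw [Option.mem_def] at hb ⊢
    obtain ⟨l, hl⟩ := hpre a T T' hT
    rw [← hl, List.getElem?_append_left]
    · exact hb
    · exact (List.getElem?_eq_some_iff.1 hb).1
  have hg : Primrec₂ fun (x : α × ℕ) (T : ℕ) => (A x.1 T)[x.2]? :=
    Primrec.list_getElem?.comp (hA.comp (Primrec.fst.comp Primrec.fst) Primrec.snd)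
      (Primrec.snd.comp Primrec.fst)
  let f : α × ℕ →. β := fun x => Nat.rfindOpt fun T => (A x.1 T)[x.2]?
  have hf : Partrec f := Partrec.rfindOpt hg.to_comp
  have hmem : ∀ a i b, b ∈ f (a, i) ↔ ∃ T, (A a T)[i]? = some b := fun a i b =>
    Nat.rfindOpt_mono (fun hT hb => hmono a i hT hb)
  refine ⟨fun a i b => b ∈ f (a, i), ?_, ⟨f, hf, fun _ _ _ => Iff.rfl⟩, ?_, ?_, ?_⟩
  · exact (mem_partrec hf).comp ((Primrec.snd.comp Primrec.snd).pair
      (Primrec.fst.pair (Primrec.fst.comp Primrec.snd)))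
  · intro a i j b hi hj
    obtain ⟨T, hT⟩ := (hmem a i b).1 hi
    obtain ⟨T', hT'⟩ := (hmem a j b).1 hj
    have h1 := hmono a i (le_max_left T T') hT
    have h2 := hmono a j (le_max_right T T') hT'
    rw [Option.mem_def, List.getElem?_eq_some_iff] at h1 h2
    obtain ⟨h1, e1⟩ := h1
    obtain ⟨h2, e2⟩ := h2
    exact (List.Nodup.getElem_inj_iff (hnd a _)).1 (e1.trans e2.symm)
  · intro a i b hi
    obtain ⟨T, hT⟩ := (hmem a i b).1 hi
    exact hsound a T b (List.mem_of_getElem? hT)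
  · intro a b N hb hN
    obtain ⟨T, hT⟩ := hcomp a b hb
    obtain ⟨i, hi, e⟩ := List.mem_iff_getElem.1 hT
    refine ⟨i, ?_, (hmem a i b).2 ⟨T, by simp [hi, e]⟩⟩
    have := hN (A a T).toFinset (by simpa using hsound a T)
    rw [List.toFinset_card_of_nodup (hnd a T)] at this
    omega

end SigmaOne

/-! ### Strings as numbers, and descriptions by rank -/

/-- The string `s` as the number with binary digits `1s` (least significant digit first). -/
def strVal (s : Str) : ℕ := s.foldr (fun b n => 2 * n + b.toNat) 1

@[simp] theorem strVal_nil : strVal [] = 1 := rfl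

@[simp] theorem strVal_cons (b : Bool) (s : Str) : strVal (b :: s) = 2 * strVal s + b.toNat := rfl

theorem primrec_two_pow : Primrec fun n : ℕ => 2 ^ n :=
  (Primrec₂.unpaired'.1 Nat.Primrec.pow).comp (Primrec.const 2) Primrec.id

theorem primrec_strVal : Primrec strVal := by
  refine Primrec.list_foldr (β := Bool) (h := fun _ x => 2 * x.2 + x.1.toNat) Primrec.id
    (Primrec.const 1) ?_
  exact Primrec.nat_add.comp (Primrec.nat_double.comp (Primrec.snd.comp Primrec.snd))
    ((Primrec.dom_bool Bool.toNat).comp (Primrec.fst.comp Primrec.snd))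

theorem two_pow_le_strVal (s : Str) : 2 ^ s.length ≤ strVal s := by
  induction s with
  | nil => simp
  | cons b s ih => simp only [List.length_cons, strVal_cons, pow_succ]; omega

theorem strVal_lt (s : Str) : strVal s < 2 ^ (s.length + 1) := by
  induction s with
  | nil => simp
  | cons b s ih =>
    simp only [List.length_cons, strVal_cons, pow_succ] at ih ⊢
    cases b <;> simp <;> omega

theorem strVal_pos (s : Str) : 0 < strVal s := (Nat.two_pow_pos _).trans_le (two_pow_le_strVal s)

theorem strVal_injective : Function.Injective strVal := by
  intro s
  induction s with
  | nil =>
    intro t h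
    cases t with
    | nil => rfl
    | cons b t => have := strVal_pos t; simp at h; omega
  | cons b s ih =>
    intro t h
    cases t with
    | nil => have := strVal_pos s; simp at h; omega
    | cons c t =>
      simp only [strVal_cons] at h
      have hb : b = c := by cases b <;> cases c <;> simp at h ⊢ <;> omega
      subst hb
      rw [ih (by omega : strVal s = strVal t)]

theorem exists_strVal_eq (n : ℕ) (hn : 0 < n) : ∃ s, strVal s = n := by
  induction n using Nat.strong_induction_on with
  | _ n ih =>
    rcases Nat.eq_or_lt_of_le hn with h1 | h1
    · exact ⟨[], by simp; omega⟩
    · obtain ⟨s, hs⟩ := ih (n / 2) (by omega) (by omega)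
      refine ⟨decide (n % 2 = 1) :: s, ?_⟩
      rw [strVal_cons, hs]
      rcases Nat.mod_two_eq_zero_or_one n with h | h <;> simp [h] <;> omega

theorem length_eq_of_strVal {s : Str} {l : ℕ} (h1 : 2 ^ l ≤ strVal s) (h2 : strVal s < 2 ^ (l + 1)) :
    s.length = l := by
  have h3 := (Nat.pow_lt_pow_iff_right (by norm_num : 1 < 2)).1 ((two_pow_le_strVal s).trans_lt h2)
  have h4 := (Nat.pow_lt_pow_iff_right (by norm_num : 1 < 2)).1 (h1.trans_lt (strVal_lt s))
  omega

theorem length_eq_log_strVal (s : Str) : s.length = Nat.log 2 (strVal s) :=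
  (Nat.log_eq_of_pow_le_of_lt_pow (two_pow_le_strVal s) (strVal_lt s)).symm

theorem findIdx_replicate_append (k : ℕ) (q : Str) :
    (List.replicate k true ++ false :: q).findIdx (fun b => !b) = k := by
  induction k with
  | zero => simp [List.findIdx_cons]
  | succ k ih => simp [List.replicate_succ, List.findIdx_cons, ih]

/-- The number of an element in an enumeration of a set of at most `2 ^ s` elements, together with
the parameter `w`, describes the element. -/
theorem complexity_le_of_card_le {D : Machine} (hD : IsOptimal D) {Q : ℕ × List Str → Str → Prop}
    (hQ : SigmaOne fun a : (ℕ × List Str) × Str => Q a.1 a.2) :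
    ∃ c : ℕ, ∀ (w : ℕ) (v : List Str) (s : ℕ) (x : Str), Q (w, v) x →
      (∀ F : Finset Str, (∀ y ∈ F, Q (w, v) y) → F.card ≤ 2 ^ s) →
      C D x v ≤ s + 2 * Nat.log 2 (w + 1) + c := by
  obtain ⟨R, -, ⟨f, hf, hRf⟩, -, -, hR⟩ := SigmaOne.exists_rank hQ
  -- A program has the form `1ᵏ 0 s_w s_i` with `k = |s_w|`, which makes the parameter
  -- self-delimiting at the cost of doubling its length. The strings stand for `w + 1` and `i + 1`,
  -- because `strVal` is never 0.
  let idx : Str × List Str → ℕ := fun a => a.1.findIdx (fun b => !b)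
  have hidx : Primrec idx :=
    Primrec.list_findIdx Primrec.fst ((Primrec.not.comp Primrec.snd).to₂)
  have hrest : Primrec (fun a : Str × List Str => a.1.drop (idx a + 1)) :=
    Primrec.list_drop.comp (Primrec.succ.comp hidx) Primrec.fst
  have hw : Primrec fun a : Str × List Str => strVal ((a.1.drop (idx a + 1)).take (idx a)) - 1 :=
    Primrec.nat_sub.comp (primrec_strVal.comp (Primrec.list_take.comp hidx hrest)) (Primrec.const 1)
  have hi : Primrec fun a : Str × List Str => strVal ((a.1.drop (idx a + 1)).drop (idx a)) - 1 :=
    Primrec.nat_sub.comp (primrec_strVal.comp (Primrec.list_drop.comp hidx hrest)) (Primrec.const 1)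
  obtain ⟨c, hc⟩ := hD.2 _ (hf.comp (((hw.pair Primrec.snd).pair hi).to_comp))
  refine ⟨c + 1, fun w v s x hx hcard => ?_⟩
  obtain ⟨i, his, hi⟩ := hR (w, v) x (2 ^ s) hx hcard
  obtain ⟨sw, hsw⟩ := exists_strVal_eq (w + 1) (Nat.succ_pos w)
  obtain ⟨si, hsi⟩ := exists_strVal_eq (i + 1) (Nat.succ_pos i)
  have hid : idx (List.replicate sw.length true ++ false :: (sw ++ si), v) = sw.length :=
    findIdx_replicate_append _ _
  obtain ⟨p, hp, hpl⟩ := hc (List.replicate sw.length true ++ false :: (sw ++ si)) v x (by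
    simp only [hid]
    have hd : (List.replicate sw.length true ++ false :: (sw ++ si)).drop (sw.length + 1)
        = sw ++ si := by simp [List.drop_append]
    rw [hd, List.take_left, List.drop_left, hsw, hsi]
    simpa using (hRf _ _ _).1 hi)
  have h1 : C D x v ≤ p.length := Nat.sInf_le ⟨p, rfl, hp⟩
  have h2 : sw.length = Nat.log 2 (w + 1) := by rw [length_eq_log_strVal, hsw]
  have h3 : si.length ≤ s := by
    have := two_pow_le_strVal si
    rw [hsi] at this
    exact (Nat.pow_le_pow_iff_right (by norm_num : 1 < 2)).1 (this.trans his)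
  simp only [List.length_append, List.length_replicate, List.length_cons] at hpl
  omega

end Kolm

/-! ### Double counting and the basic inequalities of complexity -/

namespace Kolm

theorem one_le_log_add_two (B : ℕ) : 1 ≤ Nat.log 2 (B + 2) :=
  Nat.log_pos (by norm_num) (by omega)

/-- Count the incident pairs from both sides. -/
theorem card_mul_le_of_atLeast {α β : Type*} {P : β → α → Prop} {F : Finset β} {T u e : ℕ}
    (hF : ∀ b ∈ F, AtLeast T (P b))
    (hU : ∀ U : Finset α, (∀ a ∈ U, ∃ b ∈ F, P b a) → U.card ≤ u)
    (hE : ∀ a, ∀ G : Finset β, (∀ b ∈ G, P b a) → G.card ≤ e) : F.card * T ≤ u * e := by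
  classical
  have : ∀ b, ∃ S : Finset α, b ∈ F → T ≤ S.card ∧ ∀ a ∈ S, P b a := by
    intro b
    by_cases hb : b ∈ F
    · obtain ⟨S, h⟩ := hF b hb
      exact ⟨S, fun _ => h⟩
    · exact ⟨∅, fun h => absurd h hb⟩
  choose S hS using this
  calc F.card * T = ∑ b ∈ F, T := by simp
    _ ≤ ∑ b ∈ F, (S b).card := Finset.sum_le_sum fun b hb => (hS b hb).1
    _ = ∑ b ∈ F, ∑ a ∈ F.biUnion S, if a ∈ S b then 1 else 0 := by
        refine Finset.sum_congr rfl fun b hb => ?_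
        rw [← Finset.sum_filter, Finset.card_eq_sum_ones]
        refine Finset.sum_congr ?_ fun _ _ => rfl
        ext a
        simp only [Finset.mem_filter, Finset.mem_biUnion]
        exact ⟨fun h => ⟨⟨b, hb, h⟩, h⟩, fun h => h.2⟩
    _ = ∑ a ∈ F.biUnion S, ∑ b ∈ F, if a ∈ S b then 1 else 0 := Finset.sum_comm
    _ ≤ ∑ a ∈ F.biUnion S, e := by
        refine Finset.sum_le_sum fun a _ => ?_
        rw [← Finset.sum_filter, ← Finset.card_eq_sum_ones]
        refine hE a _ fun b hb => ?_
        simp only [Finset.mem_filter] at hb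
        exact (hS b hb.1).2 a hb.2
    _ = (F.biUnion S).card * e := by simp
    _ ≤ u * e := by
        refine Nat.mul_le_mul_right _ (hU _ fun a ha => ?_)
        obtain ⟨b, hb, h⟩ := Finset.mem_biUnion.1 ha
        exact ⟨b, hb, (hS b hb).2 a h⟩

/-- The first conclusion guarantees that the subtraction `u + e - t` is not truncated when there is
something to count. -/
theorem card_le_two_pow_of_atLeast {α β : Type*} {P : β → α → Prop} {F : Finset β} {t u e : ℕ}
    (hF : ∀ b ∈ F, AtLeast (2 ^ t) (P b))
    (hU : ∀ U : Finset α, (∀ a ∈ U, ∃ b ∈ F, P b a) → U.card ≤ 2 ^ u)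
    (hE : ∀ a, ∀ G : Finset β, (∀ b ∈ G, P b a) → G.card ≤ 2 ^ e) :
    (F.Nonempty → t ≤ u + e) ∧ F.card ≤ 2 ^ (u + e - t) := by
  have h := card_mul_le_of_atLeast hF hU hE
  rw [← pow_add] at h
  have h1 : F.Nonempty → t ≤ u + e := fun hne => by
    have := hne.card_pos
    refine (Nat.pow_le_pow_iff_right (by norm_num : 1 < 2)).1 (le_trans ?_ h)
    exact Nat.le_mul_of_pos_left _ this
  refine ⟨h1, ?_⟩
  rcases F.eq_empty_or_nonempty with rfl | hne
  · simp
  · have h2 := h1 hne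
    refine Nat.le_of_mul_le_mul_right (h.trans_eq ?_) (Nat.two_pow_pos t)
    rw [← pow_add, Nat.sub_add_cancel h2]

theorem card_lt_of_length_le {F : Finset Str} {l : ℕ} (h : ∀ p ∈ F, p.length ≤ l) :
    F.card < 2 ^ (l + 1) := by
  have h1 : F.card ≤ (Finset.Ico 1 (2 ^ (l + 1))).card := by
    refine Finset.card_le_card_of_injOn strVal (fun p hp => ?_) strVal_injective.injOn
    have h2 := strVal_lt p
    have h3 : 2 ^ (p.length + 1) ≤ 2 ^ (l + 1) :=
      Nat.pow_le_pow_right (by norm_num) (Nat.succ_le_succ (h p hp))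
    simp only [Finset.coe_Ico, Set.mem_Ico]
    exact ⟨strVal_pos p, h2.trans_le h3⟩
  simp only [Nat.card_Ico] at h1
  have := Nat.two_pow_pos (l + 1)
  omega

/-- Sets of numbers with `L + 1` binary digits correspond to sets of strings of length `L`. -/
theorem exists_finset_strVal {L : ℕ} (N : Finset ℕ) (hN : ∀ n ∈ N, 2 ^ L ≤ n ∧ n < 2 ^ (L + 1)) :
    ∃ Z : Finset Str, Z.card = N.card ∧ ∀ z ∈ Z, z.length = L ∧ strVal z ∈ N := by
  classical
  have : ∀ n, ∃ s, 0 < n → strVal s = n := fun n => by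
    by_cases hn : 0 < n
    · obtain ⟨s, hs⟩ := exists_strVal_eq n hn
      exact ⟨s, fun _ => hs⟩
    · exact ⟨[], fun h => absurd h hn⟩
  choose g hg using this
  have hpos : ∀ n ∈ N, 0 < n := fun n hn => (Nat.two_pow_pos L).trans_le (hN n hn).1
  refine ⟨N.image g, Finset.card_image_of_injOn fun a ha b hb hab => ?_, fun z hz => ?_⟩
  · rw [← hg a (hpos a ha), ← hg b (hpos b hb)]
    exact congrArg strVal hab
  · obtain ⟨n, hn, rfl⟩ := Finset.mem_image.1 hz
    have h := hg n (hpos n hn)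
    exact ⟨length_eq_of_strVal (h.symm.le.trans' (hN n hn).1) (h.trans_lt (hN n hn).2), by rwa [h]⟩

theorem complexity_le_length_of_mem {D : Machine} {x p : Str} {v : List Str} (h : x ∈ D (p, v)) :
    C D x v ≤ p.length := Nat.sInf_le ⟨p, rfl, h⟩

variable {D : Machine} (hD : IsOptimal D)

include hD

theorem complexity_le_iff {x : Str} {v : List Str} {l : ℕ} :
    C D x v ≤ l ↔ ∃ p : Str, p.length ≤ l ∧ x ∈ D (p, v) := by
  constructor
  · intro h
    obtain ⟨p, hp, hx⟩ := hD.exists_program x v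
    exact ⟨p, hp.trans_le h, hx⟩
  · rintro ⟨p, hp, hx⟩
    exact (complexity_le_length_of_mem hx).trans hp

theorem sigmaOne_complexity_le :
    SigmaOne fun a : Str × List Str × ℕ => C D a.1 a.2.1 ≤ a.2.2 := by
  refine SigmaOne.of_eq (p := fun a : Str × List Str × ℕ =>
    ∃ p : Str, p.length ≤ a.2.2 ∧ a.1 ∈ D (p, a.2.1)) ?_ fun a => (complexity_le_iff hD).symm
  refine SigmaOne.ex (p := fun (a : Str × List Str × ℕ) (p : Str) =>
    p.length ≤ a.2.2 ∧ a.1 ∈ D (p, a.2.1)) (SigmaOne.and ?_ ?_)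
  · exact SigmaOne.of_primrecPred (Primrec.nat_le.comp (Primrec.list_length.comp Primrec.snd)
      (Primrec.snd.comp (Primrec.snd.comp Primrec.fst)))
  · exact (SigmaOne.mem_partrec hD.1).comp ((Primrec.fst.comp Primrec.fst).pair
      (Primrec.snd.pair (Primrec.fst.comp (Primrec.snd.comp Primrec.fst))))

theorem SigmaOne.complexity_le {α : Type*} [Primcodable α] {f : α → Str} {g : α → List Str}
    {l : α → ℕ} (hf : Primrec f) (hg : Primrec g) (hl : Primrec l) :
    SigmaOne fun a => C D (f a) (g a) ≤ l a :=
  (sigmaOne_complexity_le hD).comp (hf.pair (hg.pair hl))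

theorem card_lt_of_complexity_le {F : Finset Str} {v : List Str} {l : ℕ}
    (h : ∀ x ∈ F, C D x v ≤ l) : F.card < 2 ^ (l + 1) := by
  classical
  choose g hg hx using fun x => hD.exists_program x v
  have hinj : Function.Injective g := fun a b hab =>
    Part.mem_unique (hx a) (hab ▸ hx b)
  rw [← Finset.card_image_of_injective F hinj]
  refine card_lt_of_length_le fun p hp => ?_
  obtain ⟨x, hxF, rfl⟩ := Finset.mem_image.1 hp
  exact (hg x).trans_le (h x hxF)

theorem exists_mem_le_complexity {F : Finset Str} {a : ℕ} (hF : 2 ^ a ≤ F.card) (v : List Str) :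
    ∃ z ∈ F, a ≤ C D z v := by
  by_contra! h
  rcases a with _ | a
  · rw [pow_zero] at hF
    obtain ⟨z, hz⟩ := Finset.card_pos.1 hF
    exact absurd (h z hz) (Nat.not_lt_zero _)
  · exact absurd (card_lt_of_complexity_le hD fun x hx => Nat.lt_succ_iff.1 (h x hx)) (not_lt.2 hF)

theorem exists_length_le_complexity (L : ℕ) (v : List Str) :
    ∃ z : Str, z.length = L ∧ L ≤ C D z v := by
  obtain ⟨Z, hc, hZ⟩ := exists_finset_strVal (L := L) (Finset.Ico (2 ^ L) (2 ^ (L + 1)))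
    fun n hn => Finset.mem_Ico.1 hn
  obtain ⟨z, hz, h⟩ := exists_mem_le_complexity hD (F := Z) (a := L)
    (by rw [hc, Nat.card_Ico, pow_succ]; omega) v
  exact ⟨z, (hZ z hz).1, h⟩

theorem exists_complexity_le_length : ∃ c : ℕ, ∀ (x : Str) (v : List Str),
    C D x v ≤ x.length + c := by
  obtain ⟨c, hc⟩ := hD.2 (fun a => Part.some a.1) Computable.fst.partrec
  refine ⟨c, fun x v => ?_⟩
  obtain ⟨p, hp, hl⟩ := hc x v x (Part.mem_some x)
  exact (complexity_le_length_of_mem hp).trans hl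

theorem exists_complexity_le_of_primrec {f : List Str → List Str} (hf : Primrec f) :
    ∃ c : ℕ, ∀ (x : Str) (v : List Str), C D x v ≤ C D x (f v) + c := by
  obtain ⟨c, hc⟩ := hD.2 (fun a => D (a.1, f a.2))
    (hD.1.comp (Primrec.fst.pair (hf.comp Primrec.snd)).to_comp)
  refine ⟨c, fun x v => ?_⟩
  obtain ⟨q, hq, hx⟩ := hD.exists_program x (f v)
  obtain ⟨p, hp, hl⟩ := hc q v x hx
  exact (complexity_le_length_of_mem hp).trans (hq ▸ hl)

/-- An element of an enumerable set of at most `2 ^ s` elements, given by four numbers of size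
at most `B`, has complexity at most `s + O(log B)`. -/
theorem complexity_le_add_log {Q : ℕ × ℕ × ℕ × ℕ → List Str → Str → Prop}
    (hQ : SigmaOne fun a : (ℕ × ℕ × ℕ × ℕ) × List Str × Str => Q a.1 a.2.1 a.2.2) (e : ℕ) :
    ∃ c : ℕ, ∀ (B a₁ a₂ a₃ a₄ : ℕ) (v : List Str) (s : ℕ) (x : Str),
      a₁ ≤ B + e → a₂ ≤ B + e → a₃ ≤ B + e → a₄ ≤ B + e → Q (a₁, a₂, a₃, a₄) v x →
      (∀ F : Finset Str, (∀ y ∈ F, Q (a₁, a₂, a₃, a₄) v y) → F.card ≤ 2 ^ s) →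
      C D x v ≤ s + c * Nat.log 2 (B + 2) := by
  have hu : Primrec fun a : (ℕ × List Str) × Str => a.1.1.unpair :=
    Primrec.unpair.comp (Primrec.fst.comp Primrec.fst)
  have hu1 := Primrec.unpair.comp (Primrec.fst.comp hu)
  have hu2 := Primrec.unpair.comp (Primrec.snd.comp hu)
  obtain ⟨c, hc⟩ := complexity_le_of_card_le hD
    (Q := fun a x => Q (a.1.unpair.1.unpair.1, a.1.unpair.1.unpair.2, a.1.unpair.2.unpair.1,
      a.1.unpair.2.unpair.2) a.2 x)
    (hQ.comp (((Primrec.fst.comp hu1).pair ((Primrec.snd.comp hu1).pair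
      ((Primrec.fst.comp hu2).pair (Primrec.snd.comp hu2)))).pair
      ((Primrec.snd.comp Primrec.fst).pair Primrec.snd)))
  refine ⟨8 * (e + 2) + c, fun B a₁ a₂ a₃ a₄ v s x h1 h2 h3 h4 hx hcard => ?_⟩
  have key := hc (Nat.pair (Nat.pair a₁ a₂) (Nat.pair a₃ a₄)) v s x (by simpa using hx)
    (by simpa using hcard)
  -- The four parameters are packed into one number below `(B + e + 1) ^ 4`, whose logarithm is
  -- `O(log (B + 2))`.
  have hpair : ∀ a b M : ℕ, a < M → b < M → Nat.pair a b < M ^ 2 := fun a b M ha hb =>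
    (Nat.pair_lt_max_add_one_sq a b).trans_le (Nat.pow_le_pow_left (by omega) 2)
  have hw := hpair _ _ _ (hpair a₁ a₂ (B + e + 1) (by omega) (by omega))
    (hpair a₃ a₄ (B + e + 1) (by omega) (by omega))
  have hB : B + e + 1 ≤ 2 ^ (Nat.log 2 (B + 2) + 1 + e) := by
    have h5 : B + 2 < 2 ^ (Nat.log 2 (B + 2) + 1) := Nat.lt_pow_succ_log_self (by norm_num) _
    have h6 : e + 1 ≤ 2 ^ e := Nat.lt_two_pow_self
    calc B + e + 1 ≤ (B + 2) * (e + 1) := by nlinarith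
      _ ≤ _ := by rw [pow_add]; exact Nat.mul_le_mul h5.le h6
  have hlog : Nat.log 2 (Nat.pair (Nat.pair a₁ a₂) (Nat.pair a₃ a₄) + 1)
      ≤ 4 * (Nat.log 2 (B + 2) + 1 + e) := by
    have h7 : Nat.pair (Nat.pair a₁ a₂) (Nat.pair a₃ a₄) + 1
        ≤ 2 ^ (4 * (Nat.log 2 (B + 2) + 1 + e)) := by
      calc _ ≤ ((B + e + 1) ^ 2) ^ 2 := hw
        _ ≤ ((2 ^ (Nat.log 2 (B + 2) + 1 + e)) ^ 2) ^ 2 := by gcongr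
        _ = _ := by rw [← pow_mul, ← pow_mul]; congr 1; ring
    calc _ ≤ Nat.log 2 (2 ^ (4 * (Nat.log 2 (B + 2) + 1 + e))) := Nat.log_mono_right h7
      _ = _ := Nat.log_pow (by norm_num) _
  have := one_le_log_add_two B
  nlinarith

/-- Let `m = C(y)`, `r = C(x | y)`, and let `2^t` be, up to a factor 2, the number of `y'` with
`C(y') ≤ m` and `C(x | y') ≤ r`. Given `x`, the string `y` is one of fewer than `2^(t+1)`, so `C(y |
x)` is at most about `t`. By double counting at most `2^(m+r+2-t)` strings have as many such `y'` as
`x` has, so `C(x)` is at most about `m + r - t`. Adding the two bounds eliminates `t`. -/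
theorem exists_symmetry : ∃ c : ℕ, ∀ x y : Str,
    C D x [] + C D y [x] ≤ C D y [] + C D x [y] + c * Nat.log 2 (x.length + y.length + 2) := by
  obtain ⟨e, he⟩ := exists_complexity_le_length hD
  have hhead : Primrec fun v : List Str => v.headI := Primrec.list_headI
  obtain ⟨c₁, h₁⟩ := complexity_le_add_log hD
    (Q := fun a v y => C D y [] ≤ a.1 ∧ C D v.headI [y] ≤ a.2.1)
    ((SigmaOne.complexity_le hD (Primrec.snd.comp Primrec.snd) (Primrec.const [])
      (Primrec.fst.comp Primrec.fst)).and
      (SigmaOne.complexity_le hD (hhead.comp (Primrec.fst.comp Primrec.snd))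
        (Primrec.list_cons.comp (Primrec.snd.comp Primrec.snd) (Primrec.const []))
        (Primrec.fst.comp (Primrec.snd.comp Primrec.fst)))) e
  obtain ⟨c₂, h₂⟩ := complexity_le_add_log hD
    (Q := fun a _ x => AtLeast (2 ^ a.2.2.1) fun y => C D y [] ≤ a.1 ∧ C D x [y] ≤ a.2.1)
    (SigmaOne.atLeast (p := fun (a : (ℕ × ℕ × ℕ × ℕ) × List Str × Str) y =>
        C D y [] ≤ a.1.1 ∧ C D a.2.2 [y] ≤ a.1.2.1)
      ((SigmaOne.complexity_le hD Primrec.snd (Primrec.const [])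
        (Primrec.fst.comp (Primrec.fst.comp Primrec.fst))).and
      (SigmaOne.complexity_le hD (Primrec.snd.comp (Primrec.snd.comp Primrec.fst))
        (Primrec.list_cons.comp Primrec.snd (Primrec.const []))
        (Primrec.fst.comp (Primrec.snd.comp (Primrec.fst.comp Primrec.fst)))))
      (primrec_two_pow.comp (Primrec.fst.comp (Primrec.snd.comp (Primrec.snd.comp Primrec.fst))))) (e + 1)
  refine ⟨c₁ + c₂ + 3, fun x y => ?_⟩
  set m := C D y [] with hm
  set r := C D x [y] with hr
  have hmb : m ≤ y.length + e := he y []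
  have hrb : r ≤ x.length + e := he x [y]
  have hex : ∃ t, ¬ AtLeast (2 ^ t) fun y => C D y [] ≤ m ∧ C D x [y] ≤ r := by
    refine ⟨m + 1, ?_⟩
    rintro ⟨F, hF, h⟩
    exact absurd (card_lt_of_complexity_le hD fun y hy => (h y hy).1) (not_lt.2 hF)
  classical
  obtain ⟨t, ht⟩ : ∃ t, Nat.find hex = t + 1 := by
    refine Nat.exists_eq_succ_of_ne_zero fun h0 => ?_
    have := Nat.find_spec hex
    rw [h0] at this
    exact this ⟨{y}, by simp, by simp [← hm, ← hr]⟩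
  have hno := Nat.find_spec hex
  have hyes : AtLeast (2 ^ t) fun y => C D y [] ≤ m ∧ C D x [y] ≤ r :=
    not_not.1 (Nat.find_min hex (ht ▸ Nat.lt_succ_self t))
  rw [ht] at hno
  have key₁ := h₁ (x.length + y.length) m r 0 0 [x] (t + 1) y (by omega) (by omega) (by omega)
    (by omega) ⟨hm.ge, hr.ge⟩ fun F hF => (card_lt_of_not_atLeast hno F hF).le
  have hcard : ∀ F : Finset Str,
      (∀ x' ∈ F, AtLeast (2 ^ t) fun y => C D y [] ≤ m ∧ C D x' [y] ≤ r) →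
      (F.Nonempty → t ≤ (m + 1) + (r + 1)) ∧ F.card ≤ 2 ^ ((m + 1) + (r + 1) - t) := fun F hF =>
    card_le_two_pow_of_atLeast hF
      (fun U hU => (card_lt_of_complexity_le hD fun y hy => by
        obtain ⟨_, _, h⟩ := hU y hy
        exact h.1).le)
      fun y' G hG => (card_lt_of_complexity_le hD fun x hx => (hG x hx).2).le
  have htle := (hcard {x} (by simpa using hyes)).1 (by simp)
  have htm : t ≤ m := by
    obtain ⟨F, hF, h⟩ := hyes
    have := hF.trans_lt (card_lt_of_complexity_le hD fun y hy => (h y hy).1)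
    exact Nat.lt_succ_iff.1 ((Nat.pow_lt_pow_iff_right (by norm_num : 1 < 2)).1 this)
  have key₂ := h₂ (x.length + y.length) m r t 0 [] ((m + 1) + (r + 1) - t) x (by omega) (by omega)
    (by omega) (by omega) hyes fun F hF => (hcard F hF).2
  have := one_le_log_add_two (x.length + y.length)
  have e1 : (c₁ + c₂ + 3) * Nat.log 2 (x.length + y.length + 2) =
    c₁ * Nat.log 2 (x.length + y.length + 2) + c₂ * Nat.log 2 (x.length + y.length + 2) +
    3 * Nat.log 2 (x.length + y.length + 2) := by ring
  omega

/-- There are fewer than `2^(|p|+1)` candidates for `p`, and each yields fewer than `2^(C(x | p,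
v)+1)` strings. -/
theorem exists_complexity_le_length_add (e : ℕ) : ∃ c : ℕ, ∀ (B : ℕ) (x p : Str) (v : List Str),
    p.length ≤ B + e → C D x (p :: v) ≤ B + e →
      C D x v ≤ p.length + C D x (p :: v) + c * Nat.log 2 (B + 2) := by
  obtain ⟨c, hc⟩ := complexity_le_add_log hD
    (Q := fun a v x => ∃ p : Str, p.length ≤ a.1 ∧ C D x (p :: v) ≤ a.2.1)
    (SigmaOne.ex (p := fun (a : (ℕ × ℕ × ℕ × ℕ) × List Str × Str) (p : Str) =>
        p.length ≤ a.1.1 ∧ C D a.2.2 (p :: a.2.1) ≤ a.1.2.1)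
      ((SigmaOne.of_primrecPred (Primrec.nat_le.comp (Primrec.list_length.comp Primrec.snd)
        (Primrec.fst.comp (Primrec.fst.comp Primrec.fst)))).and
      (SigmaOne.complexity_le hD (Primrec.snd.comp (Primrec.snd.comp Primrec.fst))
        (Primrec.list_cons.comp Primrec.snd (Primrec.fst.comp (Primrec.snd.comp Primrec.fst)))
        (Primrec.fst.comp (Primrec.snd.comp (Primrec.fst.comp Primrec.fst)))))) e
  refine ⟨c + 2, fun B x p v hp hx => ?_⟩
  have key := hc B p.length (C D x (p :: v)) 0 0 v (C D x (p :: v) + 1 + (p.length + 1)) x hp hx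
    (by omega) (by omega) ⟨p, le_rfl, le_rfl⟩ fun F hF => by
      classical
      have : ∀ x', ∃ q : Str, x' ∈ F → q.length ≤ p.length ∧ C D x' (q :: v) ≤ C D x (p :: v) := by
        intro x'
        by_cases h : x' ∈ F
        · obtain ⟨q, hq⟩ := hF x' h
          exact ⟨q, fun _ => hq⟩
        · exact ⟨[], fun h' => absurd h' h⟩
      choose g hg using this
      rw [pow_add]
      refine (Finset.card_le_mul_card_image (f := g) F (2 ^ (C D x (p :: v) + 1)) fun q _ => ?_).trans
        (Nat.mul_le_mul_left _ (card_lt_of_length_le fun q hq => ?_).le)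
      · refine (card_lt_of_complexity_le hD (v := q :: v) fun x' hx' => ?_).le
        obtain ⟨h1, rfl⟩ := Finset.mem_filter.1 hx'
        exact (hg x' h1).2
      · obtain ⟨x', h1, rfl⟩ := Finset.mem_image.1 hq
        exact (hg x' h1).1
  have := one_le_log_add_two B
  have e1 : (c + 2) * Nat.log 2 (B + 2) = c * Nat.log 2 (B + 2) + 2 * Nat.log 2 (B + 2) := by ring
  omega

end Kolm

/-! ### Primes and the incidence of points and curves -/

namespace Kolm

theorem primrecPred_prime : PrimrecPred Nat.Prime := by
  have h1 : PrimrecRel fun m p : ℕ => ¬ p % m = 0 ∨ m = 1 :=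
    (PrimrecPred.not (Primrec.eq.comp (Primrec.nat_mod.comp Primrec.snd Primrec.fst)
      (Primrec.const 0))).or (Primrec.eq.comp Primrec.fst (Primrec.const 1))
  have h2 : PrimrecPred fun p : ℕ => 2 ≤ p ∧ ∀ m < p, ¬ p % m = 0 ∨ m = 1 :=
    (Primrec.nat_le.comp (Primrec.const 2) Primrec.id).and
      (h1.forall_lt.comp Primrec.id Primrec.id)
  refine h2.of_eq fun p => ?_
  rw [Nat.prime_def_lt]
  simp only [Nat.dvd_iff_mod_eq_zero, imp_iff_not_or]

theorem primrec_count_prime : Primrec (Nat.count Nat.Prime) := by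
  refine (Primrec.list_length.comp
    ((Primrec.listFilter primrecPred_prime).comp Primrec.list_range)).of_eq fun n => ?_
  induction n with
  | zero => simp
  | succ n ih =>
    rw [List.range_succ, List.filter_append, List.length_append, ih, Nat.count_succ]
    by_cases h : n.Prime <;> simp [h]

/-- The `2 ^ (m + 2)`-nd prime has at most `m + primeExcess m` binary digits. -/
def primeExcess (m : ℕ) : ℕ := 2 * Nat.log 2 (m + 2) + 6

/-- Chebyshev's bound gives about `2^M / M` primes up to `2^M`. The excess is chosen so that `8 * M
≤ 2 ^ primeExcess m`, which pays for the division by `M` and for the factor 4 in `2^(m+2)`. -/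
theorem nth_prime_two_pow_le (m : ℕ) :
    Nat.nth Nat.Prime (2 ^ (m + 2)) ≤ 2 ^ (m + primeExcess m) := by
  set M := m + primeExcess m with hM
  have hexc : 8 * M ≤ 2 ^ primeExcess m := by
    have h1 : m + 2 < 2 ^ (Nat.log 2 (m + 2) + 1) := Nat.lt_pow_succ_log_self (by norm_num) _
    have h2 : Nat.log 2 (m + 2) < 2 ^ Nat.log 2 (m + 2) := Nat.lt_two_pow_self
    rw [hM, primeExcess]
    have h3 : 2 ^ (2 * Nat.log 2 (m + 2) + 6)
        = 64 * (2 ^ Nat.log 2 (m + 2) * 2 ^ Nat.log 2 (m + 2)) := by ring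
    have h4 : 1 ≤ 2 ^ Nat.log 2 (m + 2) := Nat.one_le_two_pow
    have h5 := one_le_log_add_two m
    have h6 : 2 ≤ 2 ^ Nat.log 2 (m + 2) := by
      calc 2 = 2 ^ 1 := rfl
        _ ≤ _ := Nat.pow_le_pow_right (by norm_num) h5
    rw [h3]
    rw [pow_succ] at h1
    nlinarith
  have hM0 : 0 < M := by simp [hM, primeExcess]
  have hpi : 2 ^ (m + 2) < Nat.primeCounting (2 ^ M) := by
    have h := Chebyshev.pi_ge (2 ^ M)
    have hl2 : 0 < Real.log 2 := Real.log_pos (by norm_num)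
    have hlog : Real.log ((2 ^ M : ℕ) : ℝ) = M * Real.log 2 := by
      push_cast
      rw [Real.log_pow]
    have hlog' : Real.log (((2 ^ M : ℕ) : ℝ) + 1) ≤ (M + 1) * Real.log 2 := by
      rw [show ((M : ℝ) + 1) = ((M + 1 : ℕ) : ℝ) by push_cast; rfl, ← Real.log_pow]
      refine Real.log_le_log (by positivity) ?_
      push_cast
      have : (1 : ℝ) ≤ 2 ^ M := one_le_pow₀ (by norm_num)
      rw [pow_succ]
      linarith
    have hMr : (0 : ℝ) < M := by exact_mod_cast hM0
    rw [hlog, div_le_iff₀ (by positivity)] at h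
    have h1 : (2 : ℝ) ^ M - (M + 1) ≤ Nat.primeCounting (2 ^ M) * M := by
      refine le_of_mul_le_mul_right ?_ hl2
      push_cast at h hlog'
      nlinarith
    have h2 : 2 ^ M ≤ Nat.primeCounting (2 ^ M) * M + (M + 1) := by
      have : (2 : ℝ) ^ M ≤ Nat.primeCounting (2 ^ M) * M + (M + 1) := by linarith
      exact_mod_cast this
    by_contra hc
    rw [not_lt] at hc
    have h3 : 2 ^ M ≤ 2 ^ (m + 2) * M + (M + 1) := h2.trans (by gcongr)
    have h4 : 2 ^ M = 2 ^ m * 2 ^ primeExcess m := by rw [hM, pow_add]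
    have h5 : 2 ^ m * (8 * M) ≤ 2 ^ m * 2 ^ primeExcess m := Nat.mul_le_mul_left _ hexc
    have h6 : 1 ≤ 2 ^ m := Nat.one_le_two_pow
    have h7 : 2 ^ (m + 2) = 4 * 2 ^ m := by ring
    rw [h7, h4] at h3
    have h8 : 1 * M ≤ 2 ^ m * M := Nat.mul_le_mul_right _ h6
    have h9 : 2 ^ m * (8 * M) = 8 * (2 ^ m * M) := by ring
    rw [mul_assoc] at h3
    omega
  have := Nat.nth_lt_of_lt_count (p := Nat.Prime) (n := 2 ^ M + 1) (k := 2 ^ (m + 2)) hpi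
  omega

/-- The product of distinct prime divisors divides `n`, and each factor is at least 2. -/
theorem card_primes_le {P : Finset ℕ} {n L : ℕ} (hP : ∀ p ∈ P, p.Prime ∧ p ∣ n) (hn : 0 < n)
    (hL : n < 2 ^ (L + 1)) : P.card ≤ L := by
  have h1 : ∏ p ∈ P, p ∣ n :=
    Finset.prod_primes_dvd n (fun p hp => (hP p hp).1.prime) fun p hp => (hP p hp).2
  have h2 : 2 ^ P.card ≤ ∏ p ∈ P, p := by
    rw [← Finset.prod_const]
    exact Finset.prod_le_prod' fun p hp => (hP p hp).1.two_le
  have h3 := (h2.trans (Nat.le_of_dvd hn h1)).trans_lt hL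
  exact Nat.lt_succ_iff.1 ((Nat.pow_lt_pow_iff_right (by norm_num : 1 < 2)).1 h3)

/-- The numbers form a progression of step `q`, starting at the first suitable number from `2^L` on;
since `q * 2^(L-M) ≤ 2^L`, it stays below `2^(L+1)`. -/
theorem exists_mod_eq {q j L M : ℕ} (hj : j < q) (hq : q ≤ 2 ^ M) (hM : M ≤ L) :
    ∃ N : Finset ℕ, N.card = 2 ^ (L - M) ∧ ∀ n ∈ N, (2 ^ L ≤ n ∧ n < 2 ^ (L + 1)) ∧ n % q = j := by
  have hq0 : 0 < q := by omega
  obtain ⟨r, hr, hmod⟩ : ∃ r < q, (2 ^ L + r) % q = j := by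
    refine ⟨(j + (q - 2 ^ L % q)) % q, Nat.mod_lt _ hq0, ?_⟩
    have h1 := Nat.mod_lt (2 ^ L) hq0
    rw [Nat.add_mod_mod, ← Nat.mod_add_mod, show 2 ^ L % q + (j + (q - 2 ^ L % q)) = j + q by omega, Nat.add_mod_right,
      Nat.mod_eq_of_lt hj]
  refine ⟨(Finset.range (2 ^ (L - M))).image fun k => 2 ^ L + r + q * k, ?_, ?_⟩
  · rw [Finset.card_image_of_injective, Finset.card_range]
    intro a b hab
    exact Nat.eq_of_mul_eq_mul_left hq0 (Nat.add_left_cancel hab)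
  · intro n hn
    obtain ⟨k, hk, rfl⟩ := Finset.mem_image.1 hn
    rw [Finset.mem_range] at hk
    have h1 : q * (k + 1) ≤ 2 ^ L := by
      calc q * (k + 1) ≤ 2 ^ M * 2 ^ (L - M) := Nat.mul_le_mul hq hk
        _ = 2 ^ L := by rw [← pow_add, Nat.add_sub_cancel' hM]
    refine ⟨⟨by omega, ?_⟩, by rw [Nat.add_mul_mod_self_left, hmod]⟩
    rw [pow_succ]
    rw [mul_add] at h1
    omega

/-- `z` lies on the curve with the points `(x, y)`: the residue of `z` modulo the prime attached to
`x` is the rank of `y`. Different curves have few common points. -/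
theorem exists_incidence {D : Machine} (hD : IsOptimal D) : ∃ Inc : ℕ → Str → Str → Str → Prop,
    (SigmaOne fun a : ℕ × Str × Str × Str => Inc a.1 a.2.1 a.2.2.1 a.2.2.2) ∧
    (∀ m z x y y', Inc m z x y → Inc m z x y' → y = y') ∧
    (∀ m z x y, Inc m z x y → C D x [] ≤ m ∧ C D y [] ≤ m) ∧
    (∀ m z y, m + 1 ≤ z.length → ∀ F : Finset Str, (∀ x ∈ F, Inc m z x y) → F.card ≤ z.length) ∧
    (∀ m z z', z ≠ z' → z.length = z'.length → ∀ F : Finset Str,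
      (∀ x ∈ F, ∃ y, Inc m z x y ∧ Inc m z' x y) → F.card ≤ z.length) ∧
    (∀ m L x y, C D x [] ≤ m → C D y [] ≤ m → m + primeExcess m ≤ L → ∃ Z : Finset Str,
      Z.card = 2 ^ (L - (m + primeExcess m)) ∧ ∀ z ∈ Z, z.length = L ∧ Inc m z x y) := by
  classical
  obtain ⟨R, hRs, ⟨f, -, hf⟩, hRi, hRp, hR⟩ := SigmaOne.exists_rank
    (p := fun (m : ℕ) (x : Str) => C D x [] ≤ m)
    (SigmaOne.complexity_le hD Primrec.snd (Primrec.const []) Primrec.fst)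
  have hRlt : ∀ m i x, R m i x → i < 2 ^ (m + 1) := fun m i x hi => by
    obtain ⟨i', hi', h'⟩ := hR m x (2 ^ (m + 1)) (hRp m i x hi)
      fun F hF => (card_lt_of_complexity_le hD hF).le
    rwa [hRi m i i' x hi h']
  have hRx : ∀ m i x x', R m i x → R m i x' → x = x' := fun m i x x' h h' =>
    Part.mem_unique ((hf m i x).1 h) ((hf m i x').1 h')
  have hcount : ∀ q k, q.Prime → Nat.count Nat.Prime q = k → q = Nat.nth Nat.Prime k :=
    fun q k hq hk => by rw [← hk, Nat.nth_count hq]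
  -- Here `i`, `j` are the ranks of `x`, `y`, both below `2^(m+1)`. Shifting the index of the prime
  -- by `2^(m+1)` makes `q` larger than every rank `j`, so each `y` occurs as a residue.
  let Pt : ℕ → Str → Str → Str → ℕ → ℕ → ℕ → Prop := fun m z x y i j q =>
    R m i x ∧ R m j y ∧ q.Prime ∧ Nat.count Nat.Prime q = 2 ^ (m + 1) + i ∧ strVal z % q = j
  have hcard : ∀ (F : Finset Str) (n L m : ℕ), 0 < n → n < 2 ^ (L + 1) →
      (∀ x ∈ F, ∃ i q, R m i x ∧ q.Prime ∧ Nat.count Nat.Prime q = 2 ^ (m + 1) + i ∧ q ∣ n) →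
      F.card ≤ L := by
    intro F n L m hn hnL hF
    have : ∀ x, ∃ q, x ∈ F → ∃ i, R m i x ∧ q.Prime ∧ Nat.count Nat.Prime q = 2 ^ (m + 1) + i ∧
        q ∣ n := fun x => by
      by_cases hx : x ∈ F
      · obtain ⟨i, q, h⟩ := hF x hx
        exact ⟨q, fun _ => ⟨i, h⟩⟩
      · exact ⟨0, fun h => absurd h hx⟩
    choose g hg using this
    rw [← Finset.card_image_of_injOn (s := F) (f := g)]
    · refine card_primes_le (fun p hp => ?_) hn hnL
      obtain ⟨x, hx, rfl⟩ := Finset.mem_image.1 hp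
      obtain ⟨i, -, h1, -, h2⟩ := hg x hx
      exact ⟨h1, h2⟩
    · intro x hx x' hx' hxx
      obtain ⟨i, h1, -, h2, -⟩ := hg x hx
      obtain ⟨i', h1', -, h2', -⟩ := hg x' hx'
      rw [hxx, h2'] at h2
      have : i' = i := Nat.add_left_cancel h2
      subst this
      exact hRx m i' x x' h1 h1'
  refine ⟨fun m z x y => ∃ a : ℕ × ℕ × ℕ, Pt m z x y a.1 a.2.1 a.2.2, ?_, ?_, ?_, ?_, ?_, ?_⟩
  · refine SigmaOne.ex (p := fun (b : ℕ × Str × Str × Str) (a : ℕ × ℕ × ℕ) =>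
      Pt b.1 b.2.1 b.2.2.1 b.2.2.2 a.1 a.2.1 a.2.2) ?_
    have hm : Primrec fun a : (ℕ × Str × Str × Str) × ℕ × ℕ × ℕ => a.1.1 :=
      Primrec.fst.comp Primrec.fst
    have hz : Primrec fun a : (ℕ × Str × Str × Str) × ℕ × ℕ × ℕ => a.1.2.1 :=
      Primrec.fst.comp (Primrec.snd.comp Primrec.fst)
    have hx : Primrec fun a : (ℕ × Str × Str × Str) × ℕ × ℕ × ℕ => a.1.2.2.1 :=
      Primrec.fst.comp (Primrec.snd.comp (Primrec.snd.comp Primrec.fst))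
    have hy : Primrec fun a : (ℕ × Str × Str × Str) × ℕ × ℕ × ℕ => a.1.2.2.2 :=
      Primrec.snd.comp (Primrec.snd.comp (Primrec.snd.comp Primrec.fst))
    have hi : Primrec fun a : (ℕ × Str × Str × Str) × ℕ × ℕ × ℕ => a.2.1 :=
      Primrec.fst.comp Primrec.snd
    have hj : Primrec fun a : (ℕ × Str × Str × Str) × ℕ × ℕ × ℕ => a.2.2.1 :=
      Primrec.fst.comp (Primrec.snd.comp Primrec.snd)
    have hq : Primrec fun a : (ℕ × Str × Str × Str) × ℕ × ℕ × ℕ => a.2.2.2 :=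
      Primrec.snd.comp (Primrec.snd.comp Primrec.snd)
    refine (hRs.comp (hm.pair (hi.pair hx))).and ((hRs.comp (hm.pair (hj.pair hy))).and
      (SigmaOne.of_primrecPred ((primrecPred_prime.comp hq).and (PrimrecPred.and ?_ ?_))))
    · exact Primrec.eq.comp (primrec_count_prime.comp hq)
        (Primrec.nat_add.comp (primrec_two_pow.comp (Primrec.succ.comp hm)) hi)
    · exact Primrec.eq.comp (Primrec.nat_mod.comp (primrec_strVal.comp hz) hq) hj
  · rintro m z x y y' ⟨⟨i, j, q⟩, h1, h2, h3, h4, h5⟩ ⟨⟨i', j', q'⟩, h1', h2', h3', h4', h5'⟩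
    dsimp only at *
    have e1 := hRi m i i' x h1 h1'
    subst e1
    have e2 : q = q' := (hcount _ _ h3 h4).trans (hcount _ _ h3' h4').symm
    subst e2
    have e3 : j = j' := h5.symm.trans h5'
    subst e3
    exact hRx m j y y' h2 h2'
  · rintro m z x y ⟨⟨i, j, q⟩, h1, h2, -⟩
    exact ⟨hRp _ _ _ h1, hRp _ _ _ h2⟩
  · intro m z y hmz F hF
    rcases F.eq_empty_or_nonempty with rfl | ⟨x₀, hx₀⟩
    · simp
    obtain ⟨⟨i₀, j, q₀⟩, -, hj, -⟩ := hF x₀ hx₀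
    dsimp only at hj
    have hlt := hRlt m j y hj
    have h2 := two_pow_le_strVal z
    have h3 : 2 ^ (m + 1) ≤ 2 ^ z.length := Nat.pow_le_pow_right (by norm_num) hmz
    -- The primes of all `x` joined to `y` by `z` divide `strVal z - j`; the assumption on
    -- `z.length` makes this difference positive.
    refine hcard F (strVal z - j) z.length m (by omega)
      ((Nat.sub_le _ _).trans_lt (strVal_lt z)) fun x hx => ?_
    obtain ⟨⟨i, j', q⟩, h1, h2, h3, h4, h5⟩ := hF x hx
    dsimp only at *
    have e := hRi m j j' y hj h2
    subst e
    exact ⟨i, q, h1, h3, h4, (Nat.modEq_iff_dvd' (by omega)).1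
      (show j % q = strVal z % q by rw [← h5, Nat.mod_mod])⟩
  · intro m z z' hzz hlen F hF
    have hne : strVal z ≠ strVal z' := fun h => hzz (strVal_injective h)
    have hz := strVal_lt z
    have hz' := strVal_lt z'
    rw [← hlen] at hz'
    -- The sum of the two truncated differences is the absolute difference.
    refine hcard F ((strVal z - strVal z') + (strVal z' - strVal z)) z.length m (by omega)
      (by omega) fun x hx => ?_
    obtain ⟨y, ⟨⟨i, j, q⟩, h1, h2, h3, h4, h5⟩, ⟨i', j', q'⟩, h1', h2', h3', h4', h5'⟩ := hF x hx
    dsimp only at *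
    have e1 := hRi m i i' x h1 h1'
    subst e1
    have e2 : q = q' := (hcount _ _ h3 h4).trans (hcount _ _ h3' h4').symm
    subst e2
    have e3 := hRi m j j' y h2 h2'
    subst e3
    refine ⟨i, q, h1, h3, h4, ?_⟩
    have hmod : strVal z ≡ strVal z' [MOD q] := h5.trans h5'.symm
    rcases le_total (strVal z) (strVal z') with hle | hle
    · rw [Nat.sub_eq_zero_of_le hle, zero_add]
      exact (Nat.modEq_iff_dvd' hle).1 hmod
    · rw [Nat.sub_eq_zero_of_le hle, add_zero]
      exact (Nat.modEq_iff_dvd' hle).1 hmod.symm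
  · intro m L x y hx hy hL
    have hc : ∀ F : Finset Str, (∀ x ∈ F, C D x [] ≤ m) → F.card ≤ 2 ^ (m + 1) :=
      fun F hF => (card_lt_of_complexity_le hD hF).le
    obtain ⟨i, hi, hix⟩ := hR m x _ hx hc
    obtain ⟨j, hj, hjy⟩ := hR m y _ hy hc
    set q := Nat.nth Nat.Prime (2 ^ (m + 1) + i) with hq
    have hqp : q.Prime := Nat.prime_nth_prime _
    have hqc : Nat.count Nat.Prime q = 2 ^ (m + 1) + i :=
      Nat.count_nth_of_infinite Nat.infinite_setOfPred_prime _
    have hqle : q ≤ 2 ^ (m + primeExcess m) := by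
      refine le_trans ?_ (nth_prime_two_pow_le m)
      refine (Nat.nth_le_nth Nat.infinite_setOfPred_prime).2 ?_
      have : 2 ^ (m + 2) = 2 ^ (m + 1) + 2 ^ (m + 1) := by ring
      omega
    have hjq : j < q := by
      have : Nat.count Nat.Prime q ≤ q := Nat.count_le _
      omega
    obtain ⟨N, hN, hN'⟩ := exists_mod_eq hjq hqle hL
    obtain ⟨Z, hZ, hZ'⟩ := exists_finset_strVal N fun n hn => (hN' n hn).1
    exact ⟨Z, hZ.trans hN, fun z hz => ⟨(hZ' z hz).1, ⟨i, j, q⟩, hix, hjy, hqp, hqc,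
      (hN' _ (hZ' z hz).2).2⟩⟩

end Kolm

/-! ### Random curves, and the curves that are bad for `p` -/

namespace Kolm

theorem log_mul_add_two_le (e B : ℕ) : Nat.log 2 (e * (B + 2)) ≤ Nat.log 2 (B + 2) + e := by
  rcases Nat.eq_zero_or_pos e with rfl | he
  · simp
  have h1 : B + 2 < 2 ^ (Nat.log 2 (B + 2) + 1) := Nat.lt_pow_succ_log_self (by norm_num) _
  have h2 : e < 2 ^ e := Nat.lt_two_pow_self
  refine Nat.lt_succ_iff.1 (Nat.log_lt_of_lt_pow (by positivity) ?_)
  calc e * (B + 2) < 2 ^ e * 2 ^ (Nat.log 2 (B + 2) + 1) := Nat.mul_lt_mul'' h2 h1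
    _ = _ := by rw [← pow_add]; congr 1; omega

/-- Bonferroni: many large sets with small pairwise intersections have a large union. -/
theorem card_mul_le_card_biUnion {α β : Type*} [DecidableEq α] [DecidableEq β] {S : β → Finset α}
    {T e : ℕ} (F : Finset β) (hT : ∀ b ∈ F, T ≤ (S b).card)
    (he : ∀ b ∈ F, ∀ b' ∈ F, b ≠ b' → (S b ∩ S b').card ≤ e) :
    F.card * T ≤ (F.biUnion S).card + F.card ^ 2 * e := by
  induction F using Finset.induction_on with
  | empty => simp
  | insert b F hb ih =>
    have ih := ih (fun b' h => hT b' (Finset.mem_insert_of_mem h)) fun b₁ h₁ b₂ h₂ =>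
      he b₁ (Finset.mem_insert_of_mem h₁) b₂ (Finset.mem_insert_of_mem h₂)
    have h1 : (S b ∩ F.biUnion S).card ≤ F.card * e := by
      rw [Finset.inter_biUnion]
      refine (Finset.card_biUnion_le_card_mul _ _ e fun b' hb' => ?_)
      exact he b (Finset.mem_insert_self _ _) b' (Finset.mem_insert_of_mem hb')
        fun h => hb (h ▸ hb')
    have h2 := Finset.card_union_add_card_inter (S b) (F.biUnion S)
    have h3 := hT b (Finset.mem_insert_self _ _)
    rw [Finset.biUnion_insert, Finset.card_insert_of_notMem hb]
    nlinarith

variable {D : Machine} (hD : IsOptimal D)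

include hD

/-- Either only few `z` that are simple given `u` lie on a curve with `u` and `w`, or `w` is
simple given `u`. -/
theorem not_atLeast_or_complexity_le {J : ℕ → Str → Str → Str → Prop}
    (hJ : SigmaOne fun a : ℕ × Str × Str × Str => J a.1 a.2.1 a.2.2.1 a.2.2.2) :
    ∃ c : ℕ, ∀ (B m L r t e : ℕ) (u w : Str), L ≤ B → r ≤ B → m ≤ B → t ≤ B →
      (∀ z : Str, z.length = L → ∀ G : Finset Str, (∀ w ∈ G, J m z u w) → G.card ≤ 2 ^ e) →
      (¬ AtLeast (2 ^ t) fun z : Str => z.length = L ∧ C D z [u] ≤ r ∧ J m z u w) ∨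
      C D w [u] + t ≤ r + 1 + e + c * Nat.log 2 (B + 2) := by
  have hL : Primrec fun a : ((ℕ × ℕ × ℕ × ℕ) × List Str × Str) × Str => a.1.1.1 :=
    Primrec.fst.comp (Primrec.fst.comp Primrec.fst)
  have hr : Primrec fun a : ((ℕ × ℕ × ℕ × ℕ) × List Str × Str) × Str => a.1.1.2.1 :=
    Primrec.fst.comp (Primrec.snd.comp (Primrec.fst.comp Primrec.fst))
  have hm : Primrec fun a : ((ℕ × ℕ × ℕ × ℕ) × List Str × Str) × Str => a.1.1.2.2.1 :=
    Primrec.fst.comp (Primrec.snd.comp (Primrec.snd.comp (Primrec.fst.comp Primrec.fst)))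
  have hu : Primrec fun a : ((ℕ × ℕ × ℕ × ℕ) × List Str × Str) × Str => a.1.2.1.headI :=
    Primrec.list_headI.comp (Primrec.fst.comp (Primrec.snd.comp Primrec.fst))
  have hw : Primrec fun a : ((ℕ × ℕ × ℕ × ℕ) × List Str × Str) × Str => a.1.2.2 :=
    Primrec.snd.comp (Primrec.snd.comp Primrec.fst)
  obtain ⟨c, hc⟩ := complexity_le_add_log hD
    (Q := fun a v w => AtLeast (2 ^ a.2.2.2) fun z : Str =>
      z.length = a.1 ∧ C D z [v.headI] ≤ a.2.1 ∧ J a.2.2.1 z v.headI w)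
    (SigmaOne.atLeast (p := fun (a : (ℕ × ℕ × ℕ × ℕ) × List Str × Str) (z : Str) =>
      z.length = a.1.1 ∧ C D z [a.2.1.headI] ≤ a.1.2.1 ∧ J a.1.2.2.1 z a.2.1.headI a.2.2)
      ((SigmaOne.of_primrecPred
        (Primrec.eq.comp (Primrec.list_length.comp Primrec.snd) hL)).and
        ((SigmaOne.complexity_le hD Primrec.snd
          (Primrec.list_cons.comp hu (Primrec.const [])) hr).and
        (hJ.comp (hm.pair (Primrec.snd.pair (hu.pair hw))))))
      (primrec_two_pow.comp (Primrec.snd.comp (Primrec.snd.comp (Primrec.snd.comp Primrec.fst))))) 0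
  refine ⟨c, fun B m L r t e u w h1 h2 h3 h4 hdeg => ?_⟩
  refine or_iff_not_imp_left.2 fun hw => ?_
  rw [not_not] at hw
  -- Fewer than `2^(r+1)` strings `z` are simple given `u`, and each meets at most `2^e` strings
  -- `w`; hence few `w` are met by `2^t` of them.
  have hcard : ∀ F : Finset Str, (∀ w ∈ F, AtLeast (2 ^ t) fun z : Str =>
      z.length = L ∧ C D z [u] ≤ r ∧ J m z u w) →
      (F.Nonempty → t ≤ (r + 1) + e) ∧ F.card ≤ 2 ^ ((r + 1) + e - t) := fun F hF =>
    card_le_two_pow_of_atLeast hF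
      (fun U hU => (card_lt_of_complexity_le hD fun z hz => by
        obtain ⟨_, _, h⟩ := hU z hz
        exact h.2.1).le)
      fun z G hG => by
        rcases G.eq_empty_or_nonempty with rfl | ⟨w', hw'⟩
        · simp
        · exact hdeg z (hG w' hw').1 G fun w hw => (hG w hw).2.2
  have htle := (hcard {w} (by simpa using hw)).1 (by simp)
  have := hc B L r m t [u] ((r + 1) + e - t) w h1 h2 h3 h4 hw fun F hF => (hcard F hF).2
  omega

/-- A random curve among those with the point `(x, y)` is independent of `x` and of `y`. -/
theorem exists_curve {Inc : ℕ → Str → Str → Str → Prop}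
    (hs : SigmaOne fun a : ℕ × Str × Str × Str => Inc a.1 a.2.1 a.2.2.1 a.2.2.2)
    (hfun : ∀ m z x y y', Inc m z x y → Inc m z x y' → y = y')
    (hdeg : ∀ m z y, m + 1 ≤ z.length → ∀ F : Finset Str,
      (∀ x ∈ F, Inc m z x y) → F.card ≤ z.length)
    (hmany : ∀ m L x y, C D x [] ≤ m → C D y [] ≤ m → m + primeExcess m ≤ L → ∃ Z : Finset Str,
      Z.card = 2 ^ (L - (m + primeExcess m)) ∧ ∀ z ∈ Z, z.length = L ∧ Inc m z x y) :
    ∃ c : ℕ, ∀ (m L n g k : ℕ) (x y : Str), C D x [] ≤ m → C D y [] ≤ m →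
      m + primeExcess m + 1 ≤ L → n ≤ C D y [x] + g → n ≤ C D x [y] + g →
      m + primeExcess m + g + c * Nat.log 2 (L + 2) ≤ n + k →
      ∃ z : Str, z.length = L ∧ Inc m z x y ∧ L ≤ C D z [x] + k ∧ L ≤ C D z [y] + k := by
  obtain ⟨c₁, h₁⟩ := not_atLeast_or_complexity_le hD hs
  obtain ⟨c₂, h₂⟩ := not_atLeast_or_complexity_le hD (J := fun m z u w => Inc m z w u)
    (hs.comp (Primrec.fst.pair ((Primrec.fst.comp Primrec.snd).pair
      ((Primrec.snd.comp (Primrec.snd.comp Primrec.snd)).pair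
        (Primrec.fst.comp (Primrec.snd.comp Primrec.snd))))))
  refine ⟨c₁ + c₂ + 5, fun m L n g k x y hx hy hL hyx hxy hk => ?_⟩
  have hlog := one_le_log_add_two L
  have e1 : (c₁ + c₂ + 5) * Nat.log 2 (L + 2) =
    c₁ * Nat.log 2 (L + 2) + c₂ * Nat.log 2 (L + 2) + 5 * Nat.log 2 (L + 2) := by ring
  obtain ⟨Z, hZ, hZ'⟩ := hmany m L x y hx hy (by omega)
  -- For `L < k` the required lower bounds are trivial; otherwise `L - k` is a true difference.
  rcases lt_or_ge L k with hkL | hkL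
  · obtain ⟨z, hz⟩ : Z.Nonempty := by
      rw [← Finset.card_pos, hZ]
      exact Nat.two_pow_pos _
    exact ⟨z, (hZ' z hz).1, (hZ' z hz).2, by omega, by omega⟩
  -- There are exactly `2^(t+1)` curves through `(x, y)`, so two sets of fewer than `2^t` curves
  -- cannot cover them.
  · set t := L - (m + primeExcess m) - 1 with ht
    -- Given `x`, a curve determines `y`, so `e = 0`. In the other direction a curve meets at most
    -- `L` strings `x` above a given `y`, which costs a logarithm.
    have k₁ := (h₁ L m L (L - k) t 0 x y le_rfl (by omega) (by omega) (by omega)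
      fun z _ G hG => Finset.card_le_one.2 fun a ha b hb => hfun m z x a b (hG a ha) (hG b hb)).resolve_right
      (by omega)
    have k₂ := (h₂ L m L (L - k) t (Nat.log 2 (L + 2) + 1) y x le_rfl (by omega) (by omega)
      (by omega) fun z hz G hG => by
        have h3 := hdeg m z y (by omega) G hG
        have h4 : L + 2 < 2 ^ (Nat.log 2 (L + 2) + 1) := Nat.lt_pow_succ_log_self (by norm_num) _
        omega).resolve_right (by omega)
    classical
    by_contra! hno
    have hcov : Z ⊆ Z.filter (fun z => C D z [x] ≤ L - k) ∪ Z.filter (fun z => C D z [y] ≤ L - k) := by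
      intro z hz
      rw [Finset.mem_union, Finset.mem_filter, Finset.mem_filter]
      by_cases h : C D z [x] ≤ L - k
      · exact Or.inl ⟨hz, h⟩
      · exact Or.inr ⟨hz, by have := hno z (hZ' z hz).1 (hZ' z hz).2 (by omega); omega⟩
    have hc := (Finset.card_le_card hcov).trans (Finset.card_union_le _ _)
    have c1 := card_lt_of_not_atLeast k₁ (Z.filter (fun z => C D z [x] ≤ L - k)) fun z hz => by
      rw [Finset.mem_filter] at hz
      exact ⟨(hZ' z hz.1).1, hz.2, (hZ' z hz.1).2⟩
    have c2 := card_lt_of_not_atLeast k₂ (Z.filter (fun z => C D z [y] ≤ L - k)) fun z hz => by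
      rw [Finset.mem_filter] at hz
      exact ⟨(hZ' z hz.1).1, hz.2, (hZ' z hz.1).2⟩
    have : 2 ^ (L - (m + primeExcess m)) = 2 ^ t + 2 ^ t := by
      rw [show L - (m + primeExcess m) = t + 1 by omega]; ring
    omega

/-- If `p` is useful to get `x` given `y`, and `z` is on a curve with the point `(x, y)`, then
`p` is useful to get `x` given `z`, or `z` is one of few curves that `p` is bad for. -/
theorem complexity_le_or_complexity_le {Inc : ℕ → Str → Str → Str → Prop}
    (hs : SigmaOne fun a : ℕ × Str × Str × Str => Inc a.1 a.2.1 a.2.2.1 a.2.2.2)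
    (hfun : ∀ m z x y y', Inc m z x y → Inc m z x y' → y = y')
    (hC : ∀ m z x y, Inc m z x y → C D x [] ≤ m ∧ C D y [] ≤ m)
    (hint : ∀ m z z', z ≠ z' → z.length = z'.length → ∀ F : Finset Str,
      (∀ x ∈ F, ∃ y, Inc m z x y ∧ Inc m z' x y) → F.card ≤ z.length) (e : ℕ) :
    ∃ c : ℕ, ∀ (B m L t l : ℕ) (x y z p : Str), L ≤ B + e → m ≤ B + e → t ≤ B + e → l ≤ B + e →
      z.length = L → Inc m z x y → C D x [p, y] ≤ l → (m + l + 4 - t) + Nat.log 2 (L + 2) + 2 ≤ t →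
      C D x [p, z] ≤ t + c * Nat.log 2 (B + 2) ∨
      C D z [p] ≤ (m + l + 4 - t) + c * Nat.log 2 (B + 2) := by
  have hpy : ∀ {α : Type} [Primcodable α] {f g : α → Str}, Primrec f → Primrec g →
      Primrec fun a => [f a, g a] := fun hf hg =>
    Primrec.list_cons.comp hf (Primrec.list_cons.comp hg (Primrec.const []))
  obtain ⟨c₁, h₁⟩ := complexity_le_add_log hD
    (Q := fun a v x => ∃ y, Inc a.1 (v.getD 1 []) x y ∧ C D x [v.headI, y] ≤ a.2.1)
    (SigmaOne.ex (p := fun (a : (ℕ × ℕ × ℕ × ℕ) × List Str × Str) y =>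
        Inc a.1.1 (a.2.1.getD 1 []) a.2.2 y ∧ C D a.2.2 [a.2.1.headI, y] ≤ a.1.2.1) (by
      have hv : Primrec fun a : ((ℕ × ℕ × ℕ × ℕ) × List Str × Str) × Str => a.1.2.1 :=
        Primrec.fst.comp (Primrec.snd.comp Primrec.fst)
      have hx : Primrec fun a : ((ℕ × ℕ × ℕ × ℕ) × List Str × Str) × Str => a.1.2.2 :=
        Primrec.snd.comp (Primrec.snd.comp Primrec.fst)
      exact (hs.comp ((Primrec.fst.comp (Primrec.fst.comp Primrec.fst)).pair
        (((Primrec.list_getD []).comp hv (Primrec.const 1)).pair (hx.pair Primrec.snd)))).and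
        (SigmaOne.complexity_le hD hx (hpy (Primrec.list_headI.comp hv) Primrec.snd)
        (Primrec.fst.comp (Primrec.snd.comp (Primrec.fst.comp Primrec.fst)))))) e
  obtain ⟨c₂, h₂⟩ := complexity_le_add_log hD
    (Q := fun a v z => z.length = a.1 ∧ AtLeast (2 ^ a.2.2.2) fun b : Str × Str =>
      Inc a.2.1 z b.1 b.2 ∧ C D b.1 [v.headI, b.2] ≤ a.2.2.1)
    ((SigmaOne.of_primrecPred (Primrec.eq.comp
        (Primrec.list_length.comp (Primrec.snd.comp Primrec.snd))
        (Primrec.fst.comp Primrec.fst))).and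
      (SigmaOne.atLeast (p := fun (a : (ℕ × ℕ × ℕ × ℕ) × List Str × Str) (b : Str × Str) =>
        Inc a.1.2.1 a.2.2 b.1 b.2 ∧ C D b.1 [a.2.1.headI, b.2] ≤ a.1.2.2.1) (by
        have ha : Primrec fun a : ((ℕ × ℕ × ℕ × ℕ) × List Str × Str) × (Str × Str) => a.1.1.2 :=
          Primrec.snd.comp (Primrec.fst.comp Primrec.fst)
        have hb1 : Primrec fun a : ((ℕ × ℕ × ℕ × ℕ) × List Str × Str) × (Str × Str) => a.2.1 :=
          Primrec.fst.comp Primrec.snd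
        have hb2 : Primrec fun a : ((ℕ × ℕ × ℕ × ℕ) × List Str × Str) × (Str × Str) => a.2.2 :=
          Primrec.snd.comp Primrec.snd
        exact (hs.comp ((Primrec.fst.comp ha).pair
          ((Primrec.snd.comp (Primrec.snd.comp Primrec.fst)).pair (hb1.pair hb2)))).and
          (SigmaOne.complexity_le hD hb1 (hpy (Primrec.list_headI.comp
            (Primrec.fst.comp (Primrec.snd.comp Primrec.fst))) hb2)
            (Primrec.fst.comp (Primrec.snd.comp ha))))
        (primrec_two_pow.comp (Primrec.snd.comp (Primrec.snd.comp (Primrec.snd.comp Primrec.fst))))))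
    e
  refine ⟨c₁ + c₂, fun B m L t l x y z p hLB hm ht hl hz hxy hx hcond => ?_⟩
  rw [add_mul]
  classical
  by_cases hbad : AtLeast (2 ^ t) fun b : Str × Str => Inc m z b.1 b.2 ∧ C D b.1 [p, b.2] ≤ l
  · right
    refine (h₂ B L m l t [p] (m + l + 4 - t) z hLB hm hl ht ⟨hz, hbad⟩ fun F hF => ?_).trans
      (by omega)
    set j := m + l + 4 - t with hj
    -- Take exactly `2^j` bad curves. Their sets of at least `2^t` points lie in a union of at most
    -- `2^(m+l+2)`, a quarter of `2^j * 2^t`, and the overlap term `2^(2j) * L` is at most a half: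
    -- this contradicts Bonferroni.
    by_contra! hlt
    obtain ⟨G, hGF, hG⟩ := Finset.exists_subset_card_eq hlt.le
    have : ∀ z', ∃ S : Finset (Str × Str), z' ∈ G → 2 ^ t ≤ S.card ∧
        ∀ b ∈ S, Inc m z' b.1 b.2 ∧ C D b.1 [p, b.2] ≤ l := fun z' => by
      by_cases h : z' ∈ G
      · obtain ⟨S, hS⟩ := (hF z' (hGF h)).2
        exact ⟨S, fun _ => hS⟩
      · exact ⟨∅, fun h' => absurd h' h⟩
    choose S hS using this
    have key := card_mul_le_card_biUnion (S := S) (e := L) G (fun z' h => (hS z' h).1)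
      fun z' hz' z'' hz'' hne => by
        have hl' : z'.length = L := (hF z' (hGF hz')).1
        have hl'' : z''.length = L := (hF z'' (hGF hz'')).1
        rw [← Finset.card_image_of_injOn (f := Prod.fst)]
        · rw [← hl']
          refine hint m z' z'' hne (hl'.trans hl''.symm) _ fun x' hx' => ?_
          obtain ⟨b, hb, rfl⟩ := Finset.mem_image.1 hx'
          rw [Finset.mem_inter] at hb
          exact ⟨b.2, ((hS z' hz').2 b hb.1).1, ((hS z'' hz'').2 b hb.2).1⟩
        -- A point of a curve is determined by its first coordinate, so common points may be counted
        -- by `x` alone.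
        · rintro ⟨a, b⟩ hab ⟨a', b'⟩ hab' (rfl : a = a')
          rw [Finset.mem_coe, Finset.mem_inter] at hab hab'
          rw [hfun m z' a b b' ((hS z' hz').2 _ hab.1).1 ((hS z' hz').2 _ hab'.1).1]
    have hU : (G.biUnion S).card ≤ 2 ^ (l + 1) * 2 ^ (m + 1) := by
      have hmem : ∀ b ∈ G.biUnion S, C D b.2 [] ≤ m ∧ C D b.1 [p, b.2] ≤ l := fun b hb => by
        obtain ⟨z', hz', hb⟩ := Finset.mem_biUnion.1 hb
        have := (hS z' hz').2 b hb
        exact ⟨(hC _ _ _ _ this.1).2, this.2⟩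
      refine (Finset.card_le_mul_card_image (f := Prod.snd) _ (2 ^ (l + 1)) fun y' _ => ?_).trans
        (Nat.mul_le_mul_left _ (card_lt_of_complexity_le hD (v := []) fun y' hy' => ?_).le)
      · rw [← Finset.card_image_of_injOn (f := Prod.fst)]
        · refine (card_lt_of_complexity_le hD (v := [p, y']) fun x' hx' => ?_).le
          obtain ⟨b, hb, rfl⟩ := Finset.mem_image.1 hx'
          have hb' := Finset.mem_filter.1 hb
          rw [← hb'.2]
          exact (hmem b hb'.1).2
        · rintro ⟨a, b⟩ hab ⟨a', b'⟩ hab' (rfl : a = a')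
          rw [Finset.mem_coe, Finset.mem_filter] at hab hab'
          exact Prod.ext rfl (hab.2.trans hab'.2.symm)
      · obtain ⟨b, hb, rfl⟩ := Finset.mem_image.1 hy'
        exact (hmem b hb).1
    rw [hG] at key
    have hL : L + 2 < 2 ^ (Nat.log 2 (L + 2) + 1) := Nat.lt_pow_succ_log_self (by norm_num) _
    have h5 : (2 ^ j) ^ 2 * L * 2 ≤ 2 ^ j * 2 ^ t := by
      calc (2 ^ j) ^ 2 * L * 2 ≤ (2 ^ j) ^ 2 * 2 ^ (Nat.log 2 (L + 2) + 1) * 2 := by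
            gcongr; omega
        _ = 2 ^ j * 2 ^ (j + Nat.log 2 (L + 2) + 2) := by ring
        _ ≤ 2 ^ j * 2 ^ t := by gcongr; norm_num
    have h6 : 2 ^ (l + 1) * 2 ^ (m + 1) * 4 ≤ 2 ^ j * 2 ^ t := by
      rw [← pow_add, ← pow_add, show (4 : ℕ) = 2 ^ 2 by norm_num, ← pow_add]
      exact Nat.pow_le_pow_right (by norm_num) (by omega)
    have h7 : 0 < 2 ^ j * 2 ^ t := by positivity
    omega
  · left
    refine (h₁ B m l 0 0 [p, z] t x hm hl (by omega) (by omega) ⟨y, hxy, hx⟩ fun F hF => ?_).trans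
      (by omega)
    have : ∀ x', ∃ y', x' ∈ F → Inc m z x' y' ∧ C D x' [p, y'] ≤ l := fun x' => by
      by_cases h : x' ∈ F
      · obtain ⟨y', hy'⟩ := hF x' h
        exact ⟨y', fun _ => hy'⟩
      · exact ⟨[], fun h' => absurd h' h⟩
    choose g hg using this
    rw [← Finset.card_image_of_injective (f := fun x' => (x', g x')) F fun a b hab =>
      (Prod.mk.inj hab).1]
    refine (card_lt_of_not_atLeast hbad _ fun b hb => ?_).le
    obtain ⟨x', hx', rfl⟩ := Finset.mem_image.1 hb
    exact hg x' hx'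

end Kolm

/-! ### The construction of `z` with explicit precisions -/

namespace Kolm

theorem primeExcess_le {m e B : ℕ} (h : m + 2 ≤ e * (B + 2)) :
    primeExcess m ≤ 2 * Nat.log 2 (B + 2) + (2 * e + 6) := by
  have := (Nat.log_mono_right (b := 2) h).trans (log_mul_add_two_le e B)
  simp only [primeExcess]
  omega

variable {D : Machine} (hD : IsOptimal D)

include hD

/-- Two strings of complexity about `n` that are independent have conditional complexities about
`n`. -/
theorem exists_le_complexity_of_independent (c₀ : ℕ) : ∃ c : ℕ, ∀ (n : ℕ) (x y : Str),
    n ≤ C D x [] + c₀ * Nat.log 2 (x.length + y.length + 2) →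
    n ≤ C D y [] + c₀ * Nat.log 2 (x.length + y.length + 2) →
    C D y [] ≤ C D y [x] + c₀ * Nat.log 2 (x.length + y.length + 2) →
    n ≤ C D y [x] + c * Nat.log 2 (x.length + y.length + 2) ∧
    n ≤ C D x [y] + c * Nat.log 2 (x.length + y.length + 2) := by
  obtain ⟨c, hc⟩ := exists_symmetry hD
  refine ⟨2 * c₀ + c, fun n x y hx hy hxy => ?_⟩
  have := hc x y
  rw [add_mul, mul_assoc]
  constructor <;> omega

set_option maxHeartbeats 800000 in
/-- The existence of `z` from which `x` cannot be separated by a short program that helps to get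
`x` from `y`, with all precisions made explicit. -/
theorem exists_inseparable (c₀ : ℕ) : ∃ c : ℕ, ∀ (n L : ℕ) (x y : Str),
    n ≤ C D x [] + c₀ * Nat.log 2 (x.length + y.length + 2) →
    C D x [] ≤ n + c₀ * Nat.log 2 (x.length + y.length + 2) →
    n ≤ C D y [] + c₀ * Nat.log 2 (x.length + y.length + 2) →
    C D y [] ≤ n + c₀ * Nat.log 2 (x.length + y.length + 2) →
    C D y [] ≤ C D y [x] + c₀ * Nat.log 2 (x.length + y.length + 2) → n ≤ L →
    ∃ z : Str, z.length = L ∧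
      L ≤ C D z [x] + c * Nat.log 2 (x.length + y.length + L + 2) ∧
      L ≤ C D z [y] + c * Nat.log 2 (x.length + y.length + L + 2) ∧
      n ≤ C D x [z] + c * Nat.log 2 (x.length + y.length + L + 2) ∧
      ∀ (p : Str) (g : ℕ), p.length ≤ L → n ≤ C D x [p, z] + g →
        c * (Nat.log 2 (x.length + y.length + L + p.length + 2) + g + C D x [p, y]) ≤ n →
        L ≤ p.length + c * (Nat.log 2 (x.length + y.length + L + p.length + 2) + g +
          C D x [p, y]) := by
  obtain ⟨e, he⟩ := exists_complexity_le_length hD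
  obtain ⟨cs, hcs⟩ := exists_symmetry hD
  obtain ⟨ci, hci⟩ := exists_le_complexity_of_independent hD c₀
  obtain ⟨cp, hcp⟩ := exists_complexity_le_length_add hD e
  obtain ⟨ce, hce⟩ := exists_complexity_le_of_primrec hD (f := fun _ => []) (Primrec.const [])
  obtain ⟨ch, hch⟩ := exists_complexity_le_of_primrec hD (f := fun v => [v.headI])
    (Primrec.list_cons.comp Primrec.list_headI (Primrec.const []))
  obtain ⟨ct, hct⟩ := exists_complexity_le_of_primrec hD (f := fun v => v.tail) Primrec.list_tail
  obtain ⟨Inc, hs, hfun, hC, hdeg, hint, hmany⟩ := exists_incidence hD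
  obtain ⟨cc, hcc⟩ := exists_curve hD hs hfun hdeg hmany
  obtain ⟨cb, hcb⟩ := complexity_le_or_complexity_le hD hs hfun hC hint e
  -- the bound for the number of bits of the primes
  set cx := 2 * (c₀ + 1) + 8 with hcx
  -- the precision with which `z` is incompressible given `x` or `y`
  set cz := c₀ + cx + ci + cc + ch + ct + 1 with hcz
  refine ⟨cz + c₀ + e + cs + cx + ci + cp + ce + 2 * cb + 20, fun n L x y hx hx' hy hy' hxy hnL => ?_⟩
  obtain ⟨hyx, hxy'⟩ := hci n x y hx hy hxy
  set M := x.length + y.length with hM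
  set μ := Nat.log 2 (M + 2) with hμ
  set lam := Nat.log 2 (M + L + 2) with hlam
  have hμ1 : 1 ≤ μ := one_le_log_add_two M
  have hμlam : μ ≤ lam := Nat.log_mono_right (by omega)
  have hLlam : Nat.log 2 (L + 2) ≤ lam := Nat.log_mono_right (by omega)
  have hμM : μ ≤ M + 2 := Nat.log_le_self _ _
  have hexc : primeExcess (n + c₀ * μ) ≤ cx * lam := by
    have h1 : n + c₀ * μ + 2 ≤ (c₀ + 1) * (M + L + 2) := by nlinarith
    have h2 := primeExcess_le h1
    have h3 : cx * 1 ≤ cx * lam := Nat.mul_le_mul_left _ (hμ1.trans hμlam)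
    have h4 : 2 * lam + (2 * (c₀ + 1) + 6) ≤ cx * lam := by
      rw [hcx]
      nlinarith [hμ1.trans hμlam]
    omega
  have m1 : ∀ c : ℕ, c ≤ c * lam := fun c => Nat.le_mul_of_pos_right _ (by omega)
  have m2 : ∀ c : ℕ, c * μ ≤ c * lam := fun c => Nat.mul_le_mul_left _ hμlam
  have hz : ∃ z : Str, z.length = L ∧ L ≤ C D z [x] + cz * lam ∧ L ≤ C D z [y] + cz * lam ∧
      (L ≤ n + cz * lam ∨ n + c₀ * μ + primeExcess (n + c₀ * μ) + 1 ≤ L ∧ Inc (n + c₀ * μ) z x y) := by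
    have ez : cz * lam = c₀ * lam + cx * lam + ci * lam + cc * lam + ch * lam + ct * lam + lam := by
      rw [hcz]; ring
    have a1 := m2 c₀
    have a2 := m2 ci
    have a3 := m1 ch
    have a4 := m1 ct
    by_cases hcase : n + c₀ * μ + primeExcess (n + c₀ * μ) + 1 ≤ L
    · have a5 : cc * Nat.log 2 (L + 2) ≤ cc * lam := Nat.mul_le_mul_left _ hLlam
      obtain ⟨z, h1, h2, h3, h4⟩ := hcc (n + c₀ * μ) L n (ci * μ) (cz * lam) x y hx' hy' hcase hyx
        hxy' (by omega)
      exact ⟨z, h1, h3, h4, Or.inr ⟨hcase, h2⟩⟩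
    -- Here `L ≤ n + O(log)`, too short for a curve with the given prime; any `z` random given both
    -- strings will do.
    · obtain ⟨z, h1, h2⟩ := exists_length_le_complexity hD L [x, y]
      have h3 := hch z [x, y]
      have h4 := hct z [x, y]
      simp only [List.headI, List.tail] at h3 h4
      exact ⟨z, h1, by omega, by omega, Or.inl (by omega)⟩
  obtain ⟨z, hzL, hzx, hzy, hz⟩ := hz
  have htot : ∀ v : ℕ, (cz + c₀ + e + cs + cx + ci + cp + ce + 2 * cb + 20) * v =
      cz * v + c₀ * v + e * v + cs * v + cx * v + ci * v + cp * v + ce * v + 2 * (cb * v) + 20 * v :=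
    fun v => by ring
  refine ⟨z, hzL, ?_, ?_, ?_, fun p g hp hpz hn => ?_⟩
  · rw [htot]; omega
  · rw [htot]; omega
  -- By symmetry of information `C(x | z)` is at least about `C(x) + C(z | x) - C(z)`, where `C(z) ≤
  -- L + e`.
  · have h1 := hcs x z
    have h2 := he z []
    have h3 : cs * Nat.log 2 (x.length + z.length + 2) ≤ cs * lam :=
      Nat.mul_le_mul_left _ (Nat.log_mono_right (by omega))
    have h4 := m1 e
    have h5 := m2 c₀
    rw [htot]; omega
  · set l := C D x [p, y] with hl
    set nu := Nat.log 2 (M + L + p.length + 2) with hnu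
    have hlamnu : lam ≤ nu := Nat.log_mono_right (by omega)
    have hnu1 : 1 ≤ nu := by omega
    have n1 : ∀ c : ℕ, c ≤ c * nu := fun c => Nat.le_mul_of_pos_right _ (by omega)
    have n2 : ∀ c : ℕ, c * μ ≤ c * nu := fun c => Nat.mul_le_mul_left _ (hμlam.trans hlamnu)
    have n3 : ∀ c : ℕ, c * lam ≤ c * nu := fun c => Nat.mul_le_mul_left _ hlamnu
    have hll : l ≤ x.length + e := he x _
    rw [mul_add, mul_add, htot] at hn ⊢
    have b1 : 20 * g ≤ (cz + c₀ + e + cs + cx + ci + cp + ce + 2 * cb + 20) * g :=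
      Nat.mul_le_mul_right _ (Nat.le_add_left _ _)
    have b2 : 20 * l ≤ (cz + c₀ + e + cs + cx + ci + cp + ce + 2 * cb + 20) * l :=
      Nat.mul_le_mul_right _ (Nat.le_add_left _ _)
    have b3 := n3 cz
    have b4 := n2 c₀
    have b5 := n2 ci
    rcases hz with hz | ⟨hcase, hinc⟩
    -- In the short case `n ≲ C(x | y) ≤ |p| + C(x | p, y) + O(log)`, and `L` is about `n`.
    · have h1 := hcp (M + L + p.length) x p [y] (by omega) (by omega)
      rw [← hnu] at h1
      omega
    · have h1 := hcp (M + L + p.length) z p [] (by omega) ((he z [p]).trans (by omega))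
      rw [← hnu] at h1
      have h2 := hce z [x]
      have h3 := n1 ce
      have h4 : Nat.log 2 (L + 2) ≤ nu := hLlam.trans hlamnu
      -- With this `t` the first alternative would give `C(x | p, z) < n - g`. In the second, `C(z |
      -- p)` is `O(log) + g + l`, so `p` is almost as long as `z`.
      set t := n - g - cb * nu - 1 with ht
      have h5 := hcb (M + L + p.length) (n + c₀ * μ) L t l x y z p (by omega) (by omega) (by omega)
        (by omega) hzL hinc hl.ge (by omega)
      rw [← hnu] at h5
      rcases h5 with h5 | h5
      · omega
      · omega

end Kolm

/-! ### Real logarithms and the threshold for `n` -/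

namespace Kolm

theorem natLog_le_lg (N : ℕ) : (Nat.log 2 (N + 2) : ℝ) ≤ lg N := by
  have := Real.natLog_le_logb (N + 2) 2
  simpa [lg] using this

theorem lg_le_two_mul_natLog (N : ℕ) : lg N ≤ 2 * Nat.log 2 (N + 2) := by
  have h1 : (N : ℝ) + 2 ≤ 2 ^ (Nat.log 2 (N + 2) + 1) := by
    exact_mod_cast (Nat.lt_pow_succ_log_self (by norm_num : 1 < 2) (N + 2)).le
  have h2 : lg N ≤ (Nat.log 2 (N + 2) + 1 : ℕ) := by
    rw [lg, Real.logb_le_iff_le_rpow (by norm_num) (by positivity), Real.rpow_natCast]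
    exact h1
  have h3 : (1 : ℝ) ≤ Nat.log 2 (N + 2) := by exact_mod_cast one_le_log_add_two N
  push_cast at h2
  linarith

theorem one_le_lg (N : ℕ) : 1 ≤ lg N := by
  refine le_trans ?_ (natLog_le_lg N)
  exact_mod_cast one_le_log_add_two N

theorem lg_le_lg {M N : ℕ} (h : M ≤ N) : lg M ≤ lg N := by
  have : (M : ℝ) ≤ N := by exact_mod_cast h
  exact Real.logb_le_logb_of_le (by norm_num) (by positivity) (by linarith)

/-- The logarithm of a number that is polynomial in `n` and linear in `M` is negligible
compared with `n`, if `lg M` is. -/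
theorem exists_mul_lg_lt (K c : ℝ) (hc : 0 ≤ c) : ∃ k : ℝ, ∀ n M N : ℕ,
    (N : ℝ) ≤ M + 2 * ((K * n + 1) * n) → k * lg M ≤ n → c * lg N < 0.01 * n := by
  set A := 2 * |K| + 3 with hA
  have hA0 : 0 < A := by positivity
  have hl2 : 0 < Real.log 2 := Real.log_pos (by norm_num)
  set b := c * (Real.logb 2 A + 2) with hb
  have hlo := (Real.isLittleO_log_id_atTop.const_mul_left (2 * c / Real.log 2)).bound
    (show (0 : ℝ) < 0.002 by norm_num)
  obtain ⟨n₀, hn₀⟩ := Filter.eventually_atTop.1 hlo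
  -- The bound `lg N ≤ lg M + logb 2 A + 2 + 2 * logb 2 n` splits `c * lg N` into three parts: `c *
  -- lg M`, the constant `b`, and a multiple of `log n`. Each is at most `0.002 * n` beyond the
  -- threshold, and `n ≥ 1` makes the total strictly less than `0.01 * n`.
  refine ⟨max (max n₀ (500 * b)) (max (500 * c) 1), fun n M N hN hk => ?_⟩
  set k := max (max n₀ (500 * b)) (max (500 * c) 1) with hkdef
  have hM1 := one_le_lg M
  have k1 : n₀ ≤ k := (le_max_left _ _).trans (le_max_left _ _)
  have k2 : 500 * b ≤ k := (le_max_right _ _).trans (le_max_left _ _)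
  have k3 : 500 * c ≤ k := (le_max_left _ _).trans (le_max_right _ _)
  have k4 : 1 ≤ k := (le_max_right _ _).trans (le_max_right _ _)
  have hkn : k ≤ n := le_trans (le_mul_of_one_le_right (by linarith) hM1) hk
  have hn1 : (1 : ℝ) ≤ n := k4.trans hkn
  have hlogn : 2 * c / Real.log 2 * Real.log n ≤ 0.002 * n := by
    have := hn₀ n (k1.trans hkn)
    rw [Real.norm_eq_abs, Real.norm_eq_abs, id, abs_of_nonneg (by linarith : (0 : ℝ) ≤ n)] at this
    exact (le_abs_self _).trans this
  have hcM : 500 * (c * lg M) ≤ n := by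
    refine le_trans ?_ hk
    rw [← mul_assoc]
    exact mul_le_mul_of_nonneg_right k3 (by linarith)
  have hM0 : (0 : ℝ) ≤ M := Nat.cast_nonneg M
  have hbig : (N : ℝ) + 2 ≤ (M + 2) * (A * (2 * n) ^ 2) := by
    have h1 : K * n ≤ |K| * n := mul_le_mul_of_nonneg_right (le_abs_self K) (by linarith)
    have h2 : (K * n + 1) * n ≤ (|K| * n + 1) * n :=
      mul_le_mul_of_nonneg_right (by linarith) (by linarith)
    have h3 : (n : ℝ) ≤ n ^ 2 := by nlinarith
    have h4 : (|K| * n + 1) * n ≤ (|K| + 1) * n ^ 2 := by nlinarith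
    have h5 : (1 : ℝ) ≤ n ^ 2 := by nlinarith
    have h6 : (0 : ℝ) ≤ |K| := abs_nonneg K
    have h7 : (M : ℝ) + 2 ≤ (M + 2) * n ^ 2 := le_mul_of_one_le_right (by linarith) h5
    have h8 : 2 * ((|K| + 1) * (n : ℝ) ^ 2) ≤ (M + 2) * ((2 * |K| + 2) * n ^ 2) := by
      have : 0 ≤ (|K| + 1) * (n : ℝ) ^ 2 := by positivity
      nlinarith
    have h9 : ((M : ℝ) + 2) * (A * (2 * n) ^ 2)
        = 4 * ((M + 2) * n ^ 2 + (M + 2) * ((2 * |K| + 2) * n ^ 2)) := by rw [hA]; ring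
    have h10 : 0 ≤ ((M : ℝ) + 2) * n ^ 2 + (M + 2) * ((2 * |K| + 2) * n ^ 2) := by positivity
    rw [h9]
    linarith
  have hlg : lg N ≤ lg M + (Real.logb 2 A + 2 * (1 + Real.logb 2 n)) := by
    have h1 : lg N ≤ Real.logb 2 ((M + 2) * (A * (2 * n) ^ 2)) :=
      Real.logb_le_logb_of_le (by norm_num) (by positivity) hbig
    have hn0 : (n : ℝ) ≠ 0 := by linarith
    rw [Real.logb_mul (by positivity) (by positivity), Real.logb_mul hA0.ne' (by positivity),
      Real.logb_pow, Real.logb_mul (by norm_num) hn0, Real.logb_self_eq_one (by norm_num)] at h1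
    push_cast at h1
    exact h1
  have hfin : c * lg N ≤ c * lg M + b + 2 * c / Real.log 2 * Real.log n := by
    refine (mul_le_mul_of_nonneg_left hlg hc).trans_eq ?_
    rw [hb, show Real.logb 2 (n : ℝ) = Real.log n / Real.log 2 from rfl]
    ring
  linarith

end Kolm

open Kolm in
/-- For every optimal decompressor `D` and all constants `K` (in `d = O(n)`) and `c₀` (in the
hypotheses on `x`, `y`) there are a constant `c₁` and a threshold function `k`, such that the
following holds for all `n`, `d`, `x`, `y`; in particular `z` depends neither on the precision `c₂`
of the notions "useful" and "useless" nor on `p`. -/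
theorem proposition3 (D : Machine) (hD : IsOptimal D) (K c₀ : ℝ) :
    ∃ (c₁ : ℝ) (k : ℝ → ℝ), ∀ (n d : ℕ) (x y : Str),
      (d : ℝ) ≤ K * n →
      ApproxEq c₀ (x.length + y.length) (C D x []) n →
      ApproxEq c₀ (x.length + y.length) (C D y []) n →
      ApproxEq c₀ (x.length + y.length) (I D x y) 0 →
      ∃ z : Str, z.length ≤ (d + 1) * n ∧
        ApproxEq c₁ (x.length + y.length + z.length) (C D z []) ((d + 1) * n) ∧
        ApproxEq c₁ (x.length + y.length + z.length) (I D x z) 0 ∧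
        ApproxEq c₁ (x.length + y.length + z.length) (I D y z) 0 ∧
        ∀ c₂ : ℝ, k c₂ * lg (x.length + y.length) ≤ n →
          ¬ ∃ p : Str, (p.length : ℝ) < d * n + 0.99 * n ∧
            Useful D c₂ (x.length + y.length + z.length + p.length) p x y ∧
            Useless D c₂ (x.length + y.length + z.length + p.length) p x z := by
  obtain ⟨e, he⟩ := exists_complexity_le_length hD
  obtain ⟨ce, hce⟩ := exists_complexity_le_of_primrec hD (f := fun _ => []) (Primrec.const [])
  -- The factor 2 pays for replacing `lg` by the integer logarithm.
  obtain ⟨c, hc⟩ := exists_inseparable hD (2 * ⌈|c₀|⌉₊)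
  -- This coefficient of `lg N` bounds the total loss: one unit for the logarithm, one for rounding
  -- up, `c` for `C(x | z) ≈ n`, and `|c₂|` each for usefulness and uselessness.
  have hΓ : ∀ c₂ : ℝ, 0 ≤ (c : ℝ) * (2 + c + 2 * |c₂|) := fun c₂ => by positivity
  choose k hk using fun c₂ : ℝ => exists_mul_lg_lt K (c * (2 + c + 2 * |c₂|)) (hΓ c₂)
  refine ⟨c + e + ce, k, fun n d x y hd hx hy hxy => ?_⟩
  have hround : ∀ {a b : ℕ} {r : ℝ}, (a : ℝ) - b ≤ r → r ≤ c₀ * lg (x.length + y.length) →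
      a ≤ b + 2 * ⌈|c₀|⌉₊ * Nat.log 2 (x.length + y.length + 2) := by
    intro a b r h1 h2
    have h3 := lg_le_two_mul_natLog (x.length + y.length)
    have h4 := one_le_lg (x.length + y.length)
    have h5 : c₀ * lg (x.length + y.length)
        ≤ ⌈|c₀|⌉₊ * (2 * Nat.log 2 (x.length + y.length + 2)) :=
      mul_le_mul ((le_abs_self c₀).trans (Nat.le_ceil _)) h3 (by linarith) (Nat.cast_nonneg _)
    have h6 : (a : ℝ) ≤ b + 2 * ⌈|c₀|⌉₊ * Nat.log 2 (x.length + y.length + 2) := by linarith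
    exact_mod_cast h6
  obtain ⟨z, hzL, hzx, hzy, hxz, hz⟩ := hc n ((d + 1) * n) x y
    (hround ((neg_sub _ _).ge.trans (neg_le_abs _)) hx) (hround (le_abs_self _) hx)
    (hround ((neg_sub _ _).ge.trans (neg_le_abs _)) hy) (hround (le_abs_self _) hy)
    (hround (r := |I D x y - 0|) (by rw [sub_zero]; exact le_abs_self _) hxy)
    (Nat.le_mul_of_pos_left _ (Nat.succ_pos d))
  have hlam := natLog_le_lg (x.length + y.length + z.length)
  have hlg1 := one_le_lg (x.length + y.length + z.length)
  rw [← hzL] at hzx hzy hxz hz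
  set lam := Nat.log 2 (x.length + y.length + z.length + 2) with hlamdef
  have hclam : (c : ℝ) * lam ≤ c * lg (x.length + y.length + z.length) :=
    mul_le_mul_of_nonneg_left hlam (Nat.cast_nonneg c)
  have helg : (e : ℝ) ≤ e * lg (x.length + y.length + z.length) :=
    le_mul_of_one_le_right (Nat.cast_nonneg e) hlg1
  have hcelg : (ce : ℝ) ≤ ce * lg (x.length + y.length + z.length) :=
    le_mul_of_one_le_right (Nat.cast_nonneg ce) hlg1
  have hzup : (C D z [] : ℝ) ≤ z.length + e := by exact_mod_cast he z []
  have hzxup : (C D z [x] : ℝ) ≤ C D z [] + ce := by exact_mod_cast hce z [x]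
  have hzyup : (C D z [y] : ℝ) ≤ C D z [] + ce := by exact_mod_cast hce z [y]
  have hzx' : (z.length : ℝ) ≤ C D z [x] + c * lam := by exact_mod_cast hzx
  have hzy' : (z.length : ℝ) ≤ C D z [y] + c * lam := by exact_mod_cast hzy
  have hzL' : (z.length : ℝ) = (d + 1) * n := by exact_mod_cast hzL
  have e0 : (0 : ℝ) ≤ e := Nat.cast_nonneg e
  have ce0 : (0 : ℝ) ≤ ce := Nat.cast_nonneg ce
  have clam0 : (0 : ℝ) ≤ c * lam := by positivity
  refine ⟨z, hzL.le, ?_, ?_, ?_, fun c₂ hn => ?_⟩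
  · rw [ApproxEq, abs_le, add_mul, add_mul, ← hzL']
    constructor <;> linarith
  · rw [ApproxEq, abs_le, add_mul, add_mul, I]
    constructor <;> linarith
  · rw [ApproxEq, abs_le, add_mul, add_mul, I]
    constructor <;> linarith
  · rintro ⟨p, hp, huse, hless⟩
    have hn0 : (0 : ℝ) ≤ n := Nat.cast_nonneg n
    have hpz : (p.length : ℝ) ≤ z.length := by rw [hzL']; linarith
    have hzK : (z.length : ℝ) ≤ (K * n + 1) * n := by
      rw [hzL']
      exact mul_le_mul_of_nonneg_right (by linarith) hn0
    have hsmall := hk c₂ n (x.length + y.length) (x.length + y.length + z.length + p.length) (by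
      push_cast
      linarith) hn
    set N := x.length + y.length + z.length + p.length with hN
    have hlgN := one_le_lg N
    have hnu := natLog_le_lg N
    have hlamN : (lam : ℝ) ≤ lg N := hlam.trans (lg_le_lg (by omega))
    have hc₂ : c₂ * lg N ≤ |c₂| * lg N :=
      mul_le_mul_of_nonneg_right (le_abs_self c₂) (by linarith)
    have hl : (C D x [p, y] : ℝ) ≤ |c₂| * lg N := by
      have := (le_abs_self _).trans huse
      linarith
    have hg := Nat.le_ceil (|c₂| * lg N)
    have hg' := (Nat.ceil_lt_add_one (show 0 ≤ |c₂| * lg N by positivity)).le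
    set r := ⌈|c₂| * lg N⌉₊ with hr
    -- The slack `g` combines the precision of `C(x | z) ≈ n` with that of uselessness.
    have hxpz : n ≤ C D x [p, z] + (c * lam + r) := by
      have h1 := (neg_le_abs _).trans hless
      have h2 : (n : ℝ) ≤ C D x [z] + c * lam := by exact_mod_cast hxz
      have h3 : (n : ℝ) ≤ C D x [p, z] + (c * lam + r) := by linarith
      exact_mod_cast h3
    have hsum : (c * (Nat.log 2 (N + 2) + (c * lam + r) + C D x [p, y]) : ℝ)
        ≤ c * (2 + c + 2 * |c₂|) * lg N := by
      rw [mul_assoc]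
      refine mul_le_mul_of_nonneg_left ?_ (Nat.cast_nonneg c)
      have : (c : ℝ) * lam ≤ c * lg N := mul_le_mul_of_nonneg_left hlamN (Nat.cast_nonneg c)
      linarith
    have key := hz p (c * lam + r) (by exact_mod_cast hpz) hxpz (by
      have : (c * (Nat.log 2 (N + 2) + (c * lam + r) + C D x [p, y]) : ℝ) ≤ n := by linarith
      exact_mod_cast this)
    have key' : (z.length : ℝ) ≤ p.length +
        c * (Nat.log 2 (N + 2) + (c * lam + r) + C D x [p, y]) := by exact_mod_cast key
    -- Now `(d+1)n ≤ |p| + 0.01n`, against `|p| < dn + 0.99n`.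
    rw [hzL'] at key'
    linarith
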